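/- Write a permutation $\sigma$ of $[n]=\{1,\dots,n\}$ as the word $\sigma(1)\sigma(2)\cdots\sigma(n)$, with $|\sigma|=n$; let $S_n$ be the set of all of them and $S_n(\tau)$ the set of those avoiding the pattern $\tau$. For a word $w$ of distinct integers let $\mathrm{red}(w)$ be the permutation obtained by replacing each letter by its rank among the letters of $w$. For $1\le a,b\le |\sigma|+1$ let $\sigma^{(a,b)}$ be the permutation obtained from $\sigma$ by adding $1$ to every letter $\ge b$ and then inserting $b$ at the $a$-th position. An index $i$ is an excedance of $\sigma$ if $\sigma(i)>i$ and a non-excedance if $\sigma(i)\le i$; if $i$ is an excedance, $\sigma(i)$ is called an excedance value. Matching algorithm. Let $e_1<\dots<e_r$ be the excedances and $a_1<\dots<a_{n-r}$ the non-excedances of $\sigma$. Start with $p=q=1$ and repeat until $p>r$ or $q>n-r$: if $e_p>a_q$, increase $q$ by $1$; otherwise, if $\sigma(e_p)<\sigma(a_q)$, increase $p$ by $1$; otherwise call $\sigma(e_p)$ a matched excedance value (matched with $a_q$) and increase both $p$ and $q$ by $1$. The map $\Theta$. For $\sigma\in S_n(321)$ let $(P,Q)$ be the pair of insertion and recording tableaux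 of $\sigma$ under the Robinson–Schensted correspondence (they have at most two rows). Let $\Psi(\sigma)$ be the path with $2n$ steps whose first half has, for $i=1,\dots,n$, an up-step if $i$ is in the first row of $P$ and a down-step if it is in the second row, and whose second half has, for $i=n,n-1,\dots,1$, a down-step if $i$ is in the first row of $Q$ and an up-step if it is in the second row. For a Dyck path $D$ of semi-length $n$, number its up-steps from left to right by $n,n-1,\dots,1$ and its down-steps from left to right by $1,2,\dots,n$; a tunnel of $D$ joins an up-step $u$ and a down-step $d$ such that $D=A\,u\,B\,d\,C$ with $B$ and $AC$ Dyck paths. Let $\Phi^{-1}(D)$ be the permutation that sends $a$ to $b$ when the up-step numbered $a$ and the down-step numbered $b$ are joined by a tunnel. Put $\Theta=\Phi^{-1}\circ\Psi$. **Theorem.** For every $n$, $\Theta$ is a bijection from $S_n(321)$ to $S_n(132)$, and $\Theta$ and $\Theta^{-1}$ satisfy the following recursions. (1) Let $\sigma\in S_n(321)$. If $n=1$, then $\Theta(\sigma)=\sigma$. If $n>1$, let $k=\sigma(n)$, let $\pi=\mathrm{red}(\sigma(1)\cdots\sigma(n-1))$, and let $j-1$ be the number of matched excedance values of $\sigma$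 that are less than $k$. Then $\pi\in S_{n-1}(321)$, $\sigma=\pi^{(n,k)}$, the number of matched excedance values of $\pi$ that are less than $k$ is also $j-1$, and $$\Theta(\sigma)=\Theta(\pi)^{(n-k+j,\;j)}.$$ Furthermore, $n-k+j$ is the smallest non-excedance of $\Theta(\sigma)$. (2) Let $\alpha\in S_n(132)$. If $n=1$, then $\Theta^{-1}(\alpha)=\alpha$. If $n>1$, then $\alpha$ has a smallest non-excedance $k$, there is exactly one $\beta\in S_{n-1}$ with $\beta^{(k,\alpha(k))}=\alpha$, this $\beta$ lies in $S_{n-1}(132)$, and $$\Theta^{-1}(\alpha)=\Theta^{-1}(\beta)^{(n,\;n+\alpha(k)-k)}.$$ -/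

import Mathlib

/-!  Permutations of `[n] = {1, …, n}` are written linearly, as words `σ(1) σ(2) … σ(n)`.  -/

namespace ElizaldePak

/-- The `i`-th letter `σ(i)` of a word, for `1 ≤ i ≤ |σ|`. -/
def letter (σ : List ℕ) (i : ℕ) : ℕ := σ.getD (i - 1) 0

/-- `S n`: the words that contain each of `1, …, n` exactly once. -/
def S (n : ℕ) : Set (List ℕ) := {σ | σ.Perm (List.range' 1 n)}

/-- Reduction of a word with distinct letters: each letter is replaced by its position in the
increasing rearrangement of the word. -/
def red (w : List ℕ) : List ℕ := w.map fun x => w.countP fun y => y ≤ x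

/-- Some subsequence of `σ` is an occurrence of `τ`. -/
def Contains (σ τ : List ℕ) : Prop := ∃ u : List ℕ, u.Sublist σ ∧ red u = τ

/-- `S_n(τ)`: the permutations of `[n]` that avoid `τ`. -/
def Av (n : ℕ) (τ : List ℕ) : Set (List ℕ) := {σ | σ ∈ S n ∧ ¬ Contains σ τ}

/-- `σ^{a ⋊ b}`: add `b` to all letters greater than or equal to `a`. -/
def shiftFrom (a b : ℕ) (σ : List ℕ) : List ℕ := σ.map fun x => if a ≤ x then x + b else x

/-- `σ^{(a,b)}`: insert the number `b` at the `a`-th position, for `1 ≤ a, b ≤ |σ| + 1`. -/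
def ins (σ : List ℕ) (a b : ℕ) : List ℕ :=
  (shiftFrom b 1 σ).take (a - 1) ++ b :: (shiftFrom b 1 σ).drop (a - 1)

/-- The indices `i` with `σ(i) > i`, in increasing order. -/
def excedances (σ : List ℕ) : List ℕ :=
  (List.range' 1 σ.length).filter fun i => i < letter σ i

/-- The indices `i` with `σ(i) ≤ i`, in increasing order. -/
def nonExcedances (σ : List ℕ) : List ℕ :=
  (List.range' 1 σ.length).filter fun i => letter σ i ≤ i

/-- The loop of the matching algorithm; the two lists are the excedances `e_p, e_{p+1}, …` and the
non-excedances `a_q, a_{q+1}, …` that have not been processed yet. -/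
def matchLoop (σ : List ℕ) : List ℕ → List ℕ → List (ℕ × ℕ)
  | [], _ => []
  | _ :: _, [] => []
  | e :: es, a :: as =>
    if a < e then matchLoop σ (e :: es) as
    else if letter σ e < letter σ a then matchLoop σ es (a :: as)
    else (letter σ e, a) :: matchLoop σ es as
  termination_by es as => es.length + as.length

/-- The output of the matching algorithm: pairs (matched excedance value, non-excedance). -/
def matching (σ : List ℕ) : List (ℕ × ℕ) := matchLoop σ (excedances σ) (nonExcedances σ)

/-- The number of matched excedance values of `σ` that are less than `k`. -/
def matchedBelow (σ : List ℕ) (k : ℕ) : ℕ := (matching σ).countP fun m => m.1 < k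

/-- Row insertion of `x` into a row: `x` replaces the leftmost larger entry, which is returned as
the bumped entry, or is placed at the end if there is no larger entry. -/
def rowInsert (x : ℕ) : List ℕ → List ℕ × Option ℕ
  | [] => ([x], none)
  | y :: r =>
    if x < y then (x :: r, some y)
    else (y :: (rowInsert x r).1, (rowInsert x r).2)

/-- Insertion of `x` into a tableau (the list of its rows, the first row first).  The second
component is the index (from `0`) of the row that has become longer. -/
def tableauInsert (x : ℕ) : List (List ℕ) → List (List ℕ) × ℕ
  | [] => ([[x]], 0)
  | r :: T =>
    match rowInsert x r with
    | (r', none) => (r' :: T, 0)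
    | (r', some y) => (r' :: (tableauInsert y T).1, (tableauInsert y T).2 + 1)

/-- Place `x` at the end of the row of index `i`, which may be a new row. -/
def addToRow (x : ℕ) : ℕ → List (List ℕ) → List (List ℕ)
  | _, [] => [[x]]
  | 0, r :: T => (r ++ [x]) :: T
  | i + 1, r :: T => r :: addToRow x i T

/-- One step of the Robinson–Schensted algorithm: insert `(i, x)` into `(P, Q)`. -/
def rskStep (PQ : List (List ℕ) × List (List ℕ)) (ix : ℕ × ℕ) :
    List (List ℕ) × List (List ℕ) :=
  ((tableauInsert ix.2 PQ.1).1, addToRow ix.1 (tableauInsert ix.2 PQ.1).2 PQ.2)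

/-- The Robinson–Schensted correspondence: insert `(1, σ(1)), (2, σ(2)), …` in this order.
The result is the pair (insertion tableau, recording tableau). -/
def rsk (σ : List ℕ) : List (List ℕ) × List (List ℕ) :=
  ((List.range' 1 σ.length).zip σ).foldl rskStep ([], [])

/-- The word `Ψ(σ)` for a 321-avoiding `σ`.  Left half: for `i = 1, …, n` an up-step if `i` is in
the first row of `P` and a down-step otherwise.  Right half: for `i = n, …, 1` a down-step if `i` is
in the first row of `Q` and an up-step otherwise. -/
def Psi (σ : List ℕ) : List DyckStep :=
  ((List.range' 1 σ.length).map fun i =>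
    if i ∈ (rsk σ).1.headD [] then DyckStep.U else DyckStep.D) ++
  ((List.range' 1 σ.length).reverse.map fun i =>
    if i ∈ (rsk σ).2.headD [] then DyckStep.D else DyckStep.U)

/-- `w` is the word of a Dyck path. -/
def IsDyck (w : List DyckStep) : Prop := ∃ p : DyckWord, p.toList = w

/-- There is a tunnel of `w` from the `i`-th up-step to the `j`-th down-step, that is, a
decomposition `w = A u B d C` with `B` and `A C` Dyck words, where the displayed `u` is the `i`-th
up-step and the displayed `d` the `j`-th down-step of `w`. -/
def IsTunnel (w : List DyckStep) (i j : ℕ) : Prop :=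
  ∃ A B C : List DyckStep, w = A ++ DyckStep.U :: (B ++ DyckStep.D :: C) ∧
    IsDyck B ∧ IsDyck (A ++ C) ∧
    i = A.count DyckStep.U + 1 ∧ j = (A ++ B).count DyckStep.D + 1

/-- `Φ⁻¹(w)` for a Dyck word `w` of semi-length `n`: up-steps are numbered from `n` down to `1`,
down-steps from `1` up to `n`, and the letter of index `a` is the number `j` of the down-step at
which the tunnel from the up-step with number `a` (the `(n + 1 - a)`-th up-step) ends. -/
noncomputable def PhiInv (w : List DyckStep) : List ℕ :=
  (List.range' 1 (w.count DyckStep.U)).map fun a =>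
    sInf {j | IsTunnel w (w.count DyckStep.U + 1 - a) j}

/-- The map `Θ = Φ⁻¹ ∘ Ψ` of Elizalde and Pak on 321-avoiding permutations. -/
noncomputable def Theta (σ : List ℕ) : List ℕ := PhiInv (Psi σ)

/-- `Θ⁻¹`: the inverse of `Θ` as a map from `S(321) = ⋃ n, S_n(321)`. -/
noncomputable def ThetaInv : List ℕ → List ℕ :=
  Function.invFunOn Theta (⋃ n, Av n [3, 2, 1])

end ElizaldePak

/-!
Both maps of the theorem are compared with the insertion of a peak into a Dyck word.

Inserting the last letter `k` into a 321-avoiding permutation `π` changes `Ψ(π)` only by a peak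
`UD` inserted after the first `k - 1` steps, and this peak is the last one whose up-step lies in the
left half of the path, because `π` is increasing on its letters `≥ k`. The matching algorithm pairs
the excedance values with the down-steps of the left half, so `matchedBelow π k` is the number of
down-steps before the new peak. On the other side, inserting a peak into a Dyck word inserts a
letter into `Φ⁻¹`, at the position and with the value read off the numbers of up- and down-steps
around the peak. The last peak on the left yields the smallest non-excedance: a smaller one would
come from a tunnel starting further right, and the part of the path below that tunnel would contain
a later peak on the left.
-/

namespace ElizaldePak

open scoped List

theorem triplewise_iff_forall_sublist {α : Type*} {p : α → α → α → Prop} {w : List α} :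
    w.Triplewise p ↔ ∀ x y z, [x, y, z] <+ w → p x y z := by
  induction w with
  | nil => simp
  | cons a w ih =>
    rw [List.triplewise_cons, ih, List.pairwise_iff_forall_sublist]
    refine ⟨fun ⟨hhead, htail⟩ x y z hs => ?_, fun h => ⟨fun hs => h _ _ _ (hs.cons_cons a),
      fun x y z hs => h _ _ _ (hs.cons a)⟩⟩
    rcases List.cons_sublist_cons'.1 hs with hs | ⟨rfl, hs'⟩
    · exact htail x y z hs
    · exact hhead hs'

theorem not_contains_iff_triplewise {w τ : List ℕ} (hτ : τ.length = 3) :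
    ¬ Contains w τ ↔ w.Triplewise fun x y z => red [x, y, z] ≠ τ := by
  rw [triplewise_iff_forall_sublist]
  refine ⟨fun h x y z hs hr => h ⟨_, hs, hr⟩, fun h ⟨u, hs, hr⟩ => ?_⟩
  obtain ⟨x, y, z, rfl⟩ := List.length_eq_three.1 (show u.length = 3 by rw [← hτ, ← hr]; simp [red])
  exact h x y z hs hr

theorem red_triple_eq_321_iff {x y z : ℕ} : red [x, y, z] = [3, 2, 1] ↔ z < y ∧ y < x := by
  simp only [red, List.map_cons, List.map_nil, List.countP_cons, List.countP_nil,
    decide_eq_true_eq, List.cons.injEq, and_true]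
  split_ifs <;> omega

theorem red_triple_eq_132_iff {x y z : ℕ} : red [x, y, z] = [1, 3, 2] ↔ x < z ∧ z < y := by
  simp only [red, List.map_cons, List.map_nil, List.countP_cons, List.countP_nil,
    decide_eq_true_eq, List.cons.injEq, and_true]
  split_ifs <;> omega

theorem not_contains_321_iff {w : List ℕ} :
    ¬ Contains w [3, 2, 1] ↔ w.Triplewise fun x y z => ¬ (z < y ∧ y < x) := by
  simp only [not_contains_iff_triplewise, List.length_cons, List.length_nil, ne_eq,
    red_triple_eq_321_iff]

theorem not_contains_132_iff {w : List ℕ} :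
    ¬ Contains w [1, 3, 2] ↔ w.Triplewise fun x y z => ¬ (x < z ∧ z < y) := by
  simp only [not_contains_iff_triplewise, List.length_cons, List.length_nil, ne_eq,
    red_triple_eq_132_iff]

theorem mem_S_iff {n : ℕ} {w : List ℕ} :
    w ∈ S n ↔ w.Nodup ∧ ∀ x, x ∈ w ↔ 1 ≤ x ∧ x ≤ n := by
  have hmem (x : ℕ) : x ∈ List.range' 1 n ↔ 1 ≤ x ∧ x ≤ n := by
    rw [List.mem_range'_1]
    omega
  constructor
  · intro (h : w ~ List.range' 1 n)
    exact ⟨h.nodup_iff.2 List.nodup_range', fun x => h.mem_iff.trans (hmem x)⟩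
  · intro ⟨hnodup, hw⟩
    exact (List.perm_ext_iff_of_nodup hnodup List.nodup_range').2 fun x =>
      (hw x).trans (hmem x).symm

theorem length_of_mem_S {n : ℕ} {w : List ℕ} (h : w ∈ S n) : w.length = n := by
  simpa using List.Perm.length_eq h

theorem eq_of_mem_S_one {w : List ℕ} (hw : w ∈ S 1) : w = [1] :=
  List.perm_singleton.1 hw

theorem countP_lt_range' (x n : ℕ) :
    (List.range' 1 n).countP (· < x) = min (x - 1) n := by
  induction n with
  | zero => simp
  | succ n ih =>
    rw [List.range'_1_concat, List.countP_append, ih]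
    simp only [List.countP_cons, List.countP_nil, decide_eq_true_eq]
    split_ifs <;> omega

/-- The effect on a single letter of making room for a new letter `b`; the map on words is
`shiftFrom b 1`. -/
def shiftLetter (b x : ℕ) : ℕ := if b ≤ x then x + 1 else x

theorem shiftLetter_of_lt {b x : ℕ} (h : x < b) : shiftLetter b x = x := if_neg h.not_ge

theorem shiftLetter_of_le {b x : ℕ} (h : b ≤ x) : shiftLetter b x = x + 1 := if_pos h

theorem shiftLetter_strictMono (b : ℕ) : StrictMono (shiftLetter b) := by
  intro x y h
  unfold shiftLetter
  split_ifs <;> omega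

theorem shiftLetter_ne (b x : ℕ) : shiftLetter b x ≠ b := by
  unfold shiftLetter
  split_ifs <;> omega

theorem shiftFrom_eq_map (b : ℕ) (w : List ℕ) : shiftFrom b 1 w = w.map (shiftLetter b) := rfl

theorem cons_map_shiftLetter_mem_S {n b : ℕ} {w : List ℕ} (h₁ : 1 ≤ b) (h₂ : b ≤ n + 1)
    (hw : w ∈ S n) : b :: w.map (shiftLetter b) ∈ S (n + 1) := by
  rw [mem_S_iff] at hw ⊢
  have hb : b ∉ w.map (shiftLetter b) := by simp [shiftLetter_ne]
  refine ⟨List.nodup_cons.2 ⟨hb, hw.1.map (shiftLetter_strictMono b).injective⟩, fun x => ?_⟩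
  simp only [List.mem_cons, List.mem_map, hw.2]
  constructor
  · rintro (rfl | ⟨y, hy, rfl⟩)
    · omega
    · unfold shiftLetter
      split_ifs <;> omega
  · intro hx
    rcases lt_trichotomy x b with hlt | rfl | hgt
    · exact .inr ⟨x, by omega, shiftLetter_of_lt hlt⟩
    · exact .inl rfl
    · exact .inr ⟨x - 1, by omega, by rw [shiftLetter_of_le] <;> omega⟩

theorem ins_perm (w : List ℕ) (a b : ℕ) : ins w a b ~ b :: w.map (shiftLetter b) := by
  rw [ins, shiftFrom_eq_map]
  exact List.perm_middle.trans (by rw [List.take_append_drop])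

theorem ins_mem_S_iff {n a b : ℕ} {w : List ℕ} (h₁ : 1 ≤ b) (h₂ : b ≤ n + 1) :
    ins w a b ∈ S (n + 1) ↔ w ∈ S n := by
  have hrange : b :: (List.range' 1 n).map (shiftLetter b) ~ List.range' 1 (n + 1) :=
    cons_map_shiftLetter_mem_S h₁ h₂ (List.Perm.refl _)
  calc ins w a b ~ List.range' 1 (n + 1)
      ↔ b :: w.map (shiftLetter b) ~ b :: (List.range' 1 n).map (shiftLetter b) :=
        ⟨fun h => (ins_perm w a b).symm.trans (h.trans hrange.symm),
          fun h => (ins_perm w a b).trans (h.trans hrange)⟩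
    _ ↔ w.map (shiftLetter b) ~ (List.range' 1 n).map (shiftLetter b) := List.perm_cons b
    _ ↔ w ~ List.range' 1 n := List.map_perm_map_iff (shiftLetter_strictMono b).injective

theorem ins_injective {w w' : List ℕ} {a b : ℕ} (hl : w.length = w'.length)
    (h : ins w a b = ins w' a b) : w = w' := by
  obtain ⟨htake, hdrop⟩ := List.append_inj h (by simp [shiftFrom_eq_map, hl])
  have hmap : w.map (shiftLetter b) = w'.map (shiftLetter b) := by
    simpa [shiftFrom_eq_map] using congrArg₂ (· ++ ·) htake (List.cons.inj hdrop).2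
  exact List.map_injective_iff.2 (shiftLetter_strictMono b).injective hmap

theorem ins_length_add_one {w : List ℕ} {n b : ℕ} (h : w.length = n) :
    ins w (n + 1) b = w.map (shiftLetter b) ++ [b] := by
  have hlen : (w.map (shiftLetter b)).length ≤ n := by simp [h]
  simp [ins, shiftFrom_eq_map, List.take_of_length_le hlen, List.drop_of_length_le hlen]

theorem letter_append_cons (s t : List ℕ) (x : ℕ) : letter (s ++ x :: t) (s.length + 1) = x := by
  simp [letter]

theorem letter_ins {w : List ℕ} {a b : ℕ} (h₁ : 1 ≤ a) (h₂ : a ≤ w.length + 1) :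
    letter (ins w a b) a = b := by
  obtain ⟨i, rfl⟩ := Nat.exists_eq_add_of_le' h₁
  have hlen : ((shiftFrom b 1 w).take i).length = i := by simpa [shiftFrom_eq_map] using h₂
  have h := letter_append_cons ((shiftFrom b 1 w).take i) ((shiftFrom b 1 w).drop i) b
  rwa [hlen] at h

theorem map_shiftLetter_red {n k : ℕ} {s : List ℕ} (h : s ++ [k] ∈ S n) :
    (red s).map (shiftLetter k) = s := by
  obtain ⟨hnodup, hmem⟩ := mem_S_iff.1 h
  have hrank {x : ℕ} (hx : x ∈ s) : shiftLetter k (s.countP (· ≤ x)) = x := by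
    have hne : x ≠ k := (List.nodup_append.1 hnodup).2.2 x hx k (by simp)
    have hle : 1 ≤ x ∧ x ≤ n := (hmem x).1 (by simp [hx])
    have hcount : (s ++ [k]).countP (· ≤ x) = min x n := by
      simpa only [Nat.lt_succ_iff, Nat.add_sub_cancel] using
        (List.Perm.countP_eq _ h).trans (countP_lt_range' (x + 1) n)
    simp only [List.countP_append, List.countP_cons, List.countP_nil,
      decide_eq_true_eq] at hcount
    unfold shiftLetter
    split_ifs at hcount ⊢ <;> omega
  calc (red s).map (shiftLetter k)
      = s.map fun x => shiftLetter k (s.countP (· ≤ x)) := List.map_map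
    _ = s := (List.map_congr_left fun _ => hrank).trans (List.map_id' s)

/-- The letters of `w` that are at least `k` appear in weakly increasing order.  For a
321-avoiding `w` this is the condition under which appending `k` creates no occurrence of 321. -/
def IncreasingFrom (k : ℕ) (w : List ℕ) : Prop := w.Pairwise fun x y => k ≤ y → x ≤ y

theorem ins_last_mem_Av_iff {n k : ℕ} {w : List ℕ} (h₁ : 1 ≤ k) (h₂ : k ≤ n + 1) :
    ins w (n + 1) k ∈ Av (n + 1) [3, 2, 1] ↔ w ∈ Av n [3, 2, 1] ∧ IncreasingFrom k w := by
  have hlt {x y : ℕ} : shiftLetter k x < shiftLetter k y ↔ x < y :=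
    (shiftLetter_strictMono k).lt_iff_lt
  have hle {x y : ℕ} : shiftLetter k x ≤ shiftLetter k y ↔ x ≤ y :=
    (shiftLetter_strictMono k).le_iff_le
  have hk {x : ℕ} : k < shiftLetter k x ↔ k ≤ x := by
    unfold shiftLetter
    split_ifs <;> omega
  unfold Av
  simp only [Set.mem_ofPred_eq, ins_mem_S_iff h₁ h₂, and_assoc]
  refine and_congr_right fun hw => ?_
  rw [ins_length_add_one (length_of_mem_S hw), not_contains_321_iff, not_contains_321_iff,
    List.triplewise_append]
  simp [List.triplewise_map, List.pairwise_map, hlt, hle, hk, IncreasingFrom]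

theorem exists_eq_ins_last {n : ℕ} {σ : List ℕ} (hσ : σ ∈ Av (n + 1) [3, 2, 1]) :
    red (σ.take n) ∈ Av n [3, 2, 1] ∧ IncreasingFrom (letter σ (n + 1)) (red (σ.take n)) ∧
      1 ≤ letter σ (n + 1) ∧ letter σ (n + 1) ≤ n + 1 ∧
      σ = ins (red (σ.take n)) (n + 1) (letter σ (n + 1)) := by
  have hlen : σ.length = n + 1 := length_of_mem_S hσ.1
  obtain ⟨s, k, rfl⟩ := List.eq_nil_or_concat' σ |>.resolve_left (by rintro rfl; simp at hlen)
  obtain rfl : s.length = n := by simpa using hlen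
  have hins : ins (red s) (s.length + 1) k = s ++ [k] := by
    rw [ins_length_add_one (by simp [red]), map_shiftLetter_red hσ.1]
  obtain ⟨h₁, h₂⟩ := ((mem_S_iff.1 hσ.1).2 k).1 (by simp)
  rw [← hins, ins_last_mem_Av_iff h₁ h₂] at hσ
  rw [letter_append_cons, List.take_left]
  exact ⟨hσ.1, hσ.2, h₁, h₂, hins.symm⟩

/-- The first row of the insertion tableau. -/
def firstRow (w : List ℕ) : List ℕ := (rsk w).1.headD []

/-- The first row of the recording tableau. -/
def recRow (w : List ℕ) : List ℕ := (rsk w).2.headD []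

theorem forall_mem_or_exists_first_not {α : Type*} (p : α → Prop) (l : List α) :
    (∀ y ∈ l, p y) ∨ ∃ l₀ y l₁, l = l₀ ++ y :: l₁ ∧ (∀ z ∈ l₀, p z) ∧ ¬ p y := by
  induction l with
  | nil => left; simp
  | cons a l ih =>
    by_cases ha : p a
    · rcases ih with h | ⟨l₀, y, l₁, rfl, h₀, hy⟩
      · exact .inl (List.forall_mem_cons.2 ⟨ha, h⟩)
      · exact .inr ⟨a :: l₀, y, l₁, rfl, List.forall_mem_cons.2 ⟨ha, h₀⟩, hy⟩
    · exact .inr ⟨[], a, l, rfl, by simp, ha⟩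

theorem rowInsert_of_forall_le {x : ℕ} {r : List ℕ} (h : ∀ y ∈ r, y ≤ x) :
    rowInsert x r = (r ++ [x], none) := by
  induction r with
  | nil => rfl
  | cons a r ih =>
    obtain ⟨ha, h⟩ := List.forall_mem_cons.1 h
    simp [rowInsert, ha.not_gt, ih h]

theorem rowInsert_append_cons {x y : ℕ} {r₀ r₁ : List ℕ} (h : ∀ z ∈ r₀, z ≤ x) (hxy : x < y) :
    rowInsert x (r₀ ++ y :: r₁) = (r₀ ++ x :: r₁, some y) := by
  induction r₀ with
  | nil => simp [rowInsert, hxy]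
  | cons a r₀ ih =>
    obtain ⟨ha, h⟩ := List.forall_mem_cons.1 h
    simp [rowInsert, ha.not_gt, ih h]

theorem rowInsert_cases (x : ℕ) (r : List ℕ) :
    ((∀ y ∈ r, y ≤ x) ∧ rowInsert x r = (r ++ [x], none)) ∨
    ∃ r₀ y r₁, r = r₀ ++ y :: r₁ ∧ (∀ z ∈ r₀, z ≤ x) ∧ x < y ∧
      rowInsert x r = (r₀ ++ x :: r₁, some y) := by
  rcases forall_mem_or_exists_first_not (· ≤ x) r with h | ⟨r₀, y, r₁, rfl, h₀, hy⟩
  · exact .inl ⟨h, rowInsert_of_forall_le h⟩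
  · exact .inr ⟨r₀, y, r₁, rfl, h₀, not_le.1 hy, rowInsert_append_cons h₀ (not_le.1 hy)⟩

theorem rowInsert_perm (x : ℕ) (r : List ℕ) :
    (rowInsert x r).2.toList ++ (rowInsert x r).1 ~ x :: r := by
  rcases rowInsert_cases x r with ⟨-, heq⟩ | ⟨r₀, y, r₁, rfl, -, -, heq⟩
  · rw [heq]
    exact List.perm_append_singleton x r
  · rw [heq]
    calc y :: (r₀ ++ x :: r₁) ~ y :: x :: (r₀ ++ r₁) := List.perm_middle.cons y
      _ ~ x :: y :: (r₀ ++ r₁) := .swap _ _ _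
      _ ~ x :: (r₀ ++ y :: r₁) := List.perm_middle.symm.cons x

theorem pairwise_rowInsert {x : ℕ} {r : List ℕ} (hr : r.Pairwise (· ≤ ·)) :
    (rowInsert x r).1.Pairwise (· ≤ ·) := by
  rcases rowInsert_cases x r with ⟨hx, heq⟩ | ⟨r₀, y, r₁, rfl, hr₀, hxy, heq⟩
  · rw [heq]
    exact List.pairwise_append.2 ⟨hr, List.pairwise_singleton _ _, by simpa using hx⟩
  · rw [heq]
    simp only [List.pairwise_append, List.pairwise_cons, List.mem_cons, forall_eq_or_imp] at hr ⊢
    obtain ⟨h₀, ⟨hy, h₁⟩, h₀₁⟩ := hr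
    exact ⟨h₀, ⟨fun a ha => hxy.le.trans (hy a ha), h₁⟩, fun a ha => ⟨hr₀ a ha, (h₀₁ a ha).2⟩⟩

theorem rowInsert_mem_cases {x : ℕ} {r : List ℕ} (hr : r.Pairwise (· < ·)) (hx : x ∉ r) :
    ((∀ y ∈ r, y < x) ∧ (rowInsert x r).2 = none ∧ ∀ z, z ∈ (rowInsert x r).1 ↔ z ∈ r ∨ z = x) ∨
    ∃ y ∈ r, x < y ∧ (∀ z ∈ r, x < z → y ≤ z) ∧ (rowInsert x r).2 ≠ none ∧
      ∀ z, z ∈ (rowInsert x r).1 ↔ (z ∈ r ∧ z ≠ y) ∨ z = x := by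
  rcases rowInsert_cases x r with ⟨hle, heq⟩ | ⟨r₀, y, r₁, rfl, hr₀, hxy, heq⟩
  · exact .inl ⟨fun y hy => (hle y hy).lt_of_ne (ne_of_mem_of_not_mem hy hx), by simp [heq]⟩
  · simp only [List.pairwise_append, List.pairwise_cons, List.mem_cons, forall_eq_or_imp] at hr
    obtain ⟨-, ⟨hy, -⟩, h₀₁⟩ := hr
    have hne₀ {z : ℕ} (hz : z ∈ r₀) : z ≠ y := ((h₀₁ z hz).1).ne
    have hne₁ {z : ℕ} (hz : z ∈ r₁) : z ≠ y := (hy z hz).ne'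
    refine .inr ⟨y, by simp, hxy, fun z hz hxz => ?_, by simp [heq], fun z => ?_⟩
    · rcases List.mem_append.1 hz with hz | hz
      · exact absurd hxz (hr₀ z hz).not_gt
      · rcases List.mem_cons.1 hz with rfl | hz
        exacts [le_rfl, (hy z hz).le]
    · simp only [heq, List.mem_append, List.mem_cons]
      grind

theorem rowInsert_map {f : ℕ → ℕ} (hf : StrictMono f) (x : ℕ) (r : List ℕ) :
    rowInsert (f x) (r.map f) = ((rowInsert x r).1.map f, (rowInsert x r).2.map f) := by
  induction r with
  | nil => simp [rowInsert]
  | cons a r ih =>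
    simp only [List.map_cons, rowInsert, hf.lt_iff_lt, ih]
    split_ifs <;> simp

theorem tableauInsert_ne_nil (x : ℕ) (T : List (List ℕ)) : (tableauInsert x T).1 ≠ [] := by
  rcases T with _ | ⟨r, T⟩
  · simp [tableauInsert]
  · rcases h : rowInsert x r with ⟨r', _ | y⟩ <;> simp [tableauInsert, h]

theorem addToRow_ne_nil (x i : ℕ) (T : List (List ℕ)) : addToRow x i T ≠ [] := by
  rcases T with _ | ⟨r, T⟩ <;> rcases i with _ | i <;> simp [addToRow]

theorem rsk_concat (w : List ℕ) (x : ℕ) :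
    rsk (w ++ [x]) = rskStep (rsk w) (w.length + 1, x) := by
  unfold rsk
  rw [List.length_append, List.length_singleton, List.range'_1_concat,
    List.zip_append (by simp), List.foldl_append]
  simp [Nat.add_comm]

theorem firstRow_concat (w : List ℕ) (x : ℕ) :
    firstRow (w ++ [x]) = (rowInsert x (firstRow w)).1 := by
  unfold firstRow
  rw [rsk_concat]
  rcases h : (rsk w).1 with _ | ⟨r, T⟩
  · simp [rskStep, h, tableauInsert, rowInsert]
  · rcases h' : rowInsert x r with ⟨r', _ | y⟩ <;> simp [rskStep, h, tableauInsert, h']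

theorem recRow_concat (w : List ℕ) (x : ℕ) :
    recRow (w ++ [x]) = if (rowInsert x (firstRow w)).2 = none then recRow w ++ [w.length + 1]
      else recRow w := by
  unfold recRow firstRow
  rw [rsk_concat]
  rcases List.eq_nil_or_concat' w with rfl | ⟨v, y, rfl⟩
  · rfl
  rw [rsk_concat v y]
  obtain ⟨r, T, hP⟩ := List.exists_cons_of_ne_nil (tableauInsert_ne_nil y (rsk v).1)
  obtain ⟨q, T', hQ⟩ := List.exists_cons_of_ne_nil
    (addToRow_ne_nil (v.length + 1) (tableauInsert y (rsk v).1).2 (rsk v).2)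
  rcases h : rowInsert x r with ⟨r', _ | z⟩ <;>
    simp [rskStep, tableauInsert, addToRow, hP, hQ, h]

theorem firstRow_map {f : ℕ → ℕ} (hf : StrictMono f) (w : List ℕ) :
    firstRow (w.map f) = (firstRow w).map f := by
  induction w using List.reverseRecOn with
  | nil => rfl
  | append_singleton w x ih =>
    rw [List.map_append, List.map_singleton, firstRow_concat, firstRow_concat, ih,
      rowInsert_map hf]

theorem recRow_map {f : ℕ → ℕ} (hf : StrictMono f) (w : List ℕ) :
    recRow (w.map f) = recRow w := by
  induction w using List.reverseRecOn with
  | nil => rfl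
  | append_singleton w x ih =>
    rw [List.map_append, List.map_singleton, recRow_concat, recRow_concat, ih,
      firstRow_map hf, rowInsert_map hf]
    simp

theorem mem_recRow_le {w : List ℕ} {y : ℕ} (h : y ∈ recRow w) : y ≤ w.length := by
  induction w using List.reverseRecOn with
  | nil => simp [recRow, rsk] at h
  | append_singleton w x ih =>
    rw [recRow_concat] at h
    rw [List.length_append, List.length_singleton]
    split_ifs at h
    · rcases List.mem_append.1 h with h | h
      · exact (ih h).trans (Nat.le_succ _)
      · exact (List.mem_singleton.1 h).le
    · exact (ih h).trans (Nat.le_succ _)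

theorem firstRow_eq_foldl (w : List ℕ) :
    firstRow w = w.foldl (fun r x => (rowInsert x r).1) [] := by
  induction w using List.reverseRecOn with
  | nil => rfl
  | append_singleton w x ih => rw [firstRow_concat, List.foldl_concat, ih]

/-- The letters that leave the row `r`, in this order, when the letters of a word are inserted
into it one after the other. -/
def bumpedFrom (r : List ℕ) : List ℕ → List ℕ
  | [] => []
  | x :: w => (rowInsert x r).2.toList ++ bumpedFrom (rowInsert x r).1 w

theorem bumpedFrom_append_foldl_perm (r w : List ℕ) :
    bumpedFrom r w ++ w.foldl (fun r x => (rowInsert x r).1) r ~ r ++ w := by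
  induction w generalizing r with
  | nil => simp [bumpedFrom]
  | cons x w ih =>
    rw [bumpedFrom, List.foldl_cons, List.append_assoc]
    calc _ ~ (rowInsert x r).2.toList ++ ((rowInsert x r).1 ++ w) := (ih _).append_left _
      _ ~ (x :: r) ++ w := by
        rw [← List.append_assoc]
        exact (rowInsert_perm x r).append_right w
      _ ~ r ++ x :: w := List.perm_middle.symm

theorem bumpedFrom_append_firstRow_perm (w : List ℕ) : bumpedFrom [] w ++ firstRow w ~ w := by
  rw [firstRow_eq_foldl]
  exact bumpedFrom_append_foldl_perm [] w

theorem mem_of_mem_firstRow {w : List ℕ} {y : ℕ} (h : y ∈ firstRow w) : y ∈ w :=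
  (bumpedFrom_append_firstRow_perm w).subset (List.mem_append_right _ h)

theorem firstRow_pairwise {w : List ℕ} (hw : w.Nodup) : (firstRow w).Pairwise (· < ·) := by
  have hle : (firstRow w).Pairwise (· ≤ ·) := by
    clear hw
    induction w using List.reverseRecOn with
    | nil => exact .nil
    | append_singleton w x ih => exact firstRow_concat w x ▸ pairwise_rowInsert ih
  have hnodup := ((bumpedFrom_append_firstRow_perm w).nodup_iff.2 hw).of_append_right
  exact hle.imp₂ (fun _ _ => lt_of_le_of_ne) hnodup

theorem firstRow_concat_cases {w : List ℕ} {x : ℕ} (hw : (w ++ [x]).Nodup) :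
    ((∀ y ∈ firstRow w, y < x) ∧ (rowInsert x (firstRow w)).2 = none ∧
      ∀ z, z ∈ firstRow (w ++ [x]) ↔ z ∈ firstRow w ∨ z = x) ∨
    ∃ y ∈ firstRow w, x < y ∧ (∀ z ∈ firstRow w, x < z → y ≤ z) ∧
      (rowInsert x (firstRow w)).2 ≠ none ∧
      ∀ z, z ∈ firstRow (w ++ [x]) ↔ (z ∈ firstRow w ∧ z ≠ y) ∨ z = x := by
  have hx : x ∉ w := fun h => (List.nodup_append.1 hw).2.2 x h x (by simp) rfl
  rw [firstRow_concat]
  exact rowInsert_mem_cases (firstRow_pairwise hw.of_append_left)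
    fun h => hx (mem_of_mem_firstRow h)

theorem pair_sublist_concat_iff {w : List ℕ} {a b x : ℕ} :
    [a, b] <+ w ++ [x] ↔ [a, b] <+ w ∨ (a ∈ w ∧ b = x) := by
  rw [← List.reverse_sublist, List.reverse_concat, ← List.reverse_sublist (l₂ := w)]
  change [b, a] <+ x :: w.reverse ↔ [b, a] <+ w.reverse ∨ _
  rw [List.cons_sublist_cons', List.singleton_sublist, List.mem_reverse, and_comm]

theorem pair_sublist_iff_idxOf_lt {w : List ℕ} (hw : w.Nodup) {a b : ℕ} :
    [a, b] <+ w ↔ b ∈ w ∧ w.idxOf a < w.idxOf b := by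
  induction w with
  | nil => simp
  | cons c w ih =>
    obtain ⟨hc, hw⟩ := List.nodup_cons.1 hw
    rw [List.cons_sublist_cons', ih hw, List.singleton_sublist]
    by_cases hca : c = a <;> by_cases hcb : c = b <;>
      grind [List.idxOf_cons_self, List.idxOf_cons_ne]

theorem pair_sublist_total {w : List ℕ} (hw : w.Nodup) {a b : ℕ} (ha : a ∈ w) (hb : b ∈ w)
    (hab : a ≠ b) : [a, b] <+ w ∨ [b, a] <+ w := by
  rw [pair_sublist_iff_idxOf_lt hw, pair_sublist_iff_idxOf_lt hw]
  rcases lt_trichotomy (w.idxOf a) (w.idxOf b) with h | h | h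
  exacts [.inl ⟨hb, h⟩, absurd ((List.idxOf_inj ha).1 h) hab, .inr ⟨ha, h⟩]

theorem succ_mem_firstRow {w : List ℕ} {i : ℕ} (hw : w.Nodup) (h : [i, i + 1] <+ w)
    (hi : i ∈ firstRow w) : i + 1 ∈ firstRow w := by
  induction w using List.reverseRecOn with
  | nil => simp at h
  | append_singleton w x ih =>
    have hx {y : ℕ} (hy : y ∈ w) : y ≠ x := (List.nodup_append.1 hw).2.2 y hy x (by simp)
    rcases pair_sublist_concat_iff.1 h with h | ⟨-, rfl⟩
    · have hix := hx (h.subset (by simp : i ∈ [i, i + 1]))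
      have hix' := hx (h.subset (by simp : i + 1 ∈ [i, i + 1]))
      have ih := ih hw.of_append_left h
      rcases firstRow_concat_cases hw with ⟨-, -, hmem⟩ | ⟨y, -, hxy, hmin, -, hmem⟩ <;>
        rw [hmem] at hi ⊢
      · tauto
      · have hi : i ∈ firstRow w := by tauto
        refine .inl ⟨ih hi, fun hy => ?_⟩
        have := hmin i hi (by omega)
        omega
    · rcases firstRow_concat_cases hw with ⟨-, -, hmem⟩ | ⟨y, -, -, -, -, hmem⟩ <;> simp [hmem]

theorem succ_notMem_firstRow {w : List ℕ} {i : ℕ} (hw : w.Nodup) (h : [i + 1, i] <+ w) :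
    i + 1 ∉ firstRow w := by
  induction w using List.reverseRecOn with
  | nil => simp at h
  | append_singleton w x ih =>
    have hx {y : ℕ} (hy : y ∈ w) : y ≠ x := (List.nodup_append.1 hw).2.2 y hy x (by simp)
    rcases pair_sublist_concat_iff.1 h with h | ⟨-, rfl⟩
    · have hix := hx (h.subset (by simp : i + 1 ∈ [i + 1, i]))
      have ih := ih hw.of_append_left h
      rcases firstRow_concat_cases hw with ⟨-, -, hmem⟩ | ⟨y, -, -, -, -, hmem⟩ <;>
      · rw [hmem]
        tauto
    · rcases firstRow_concat_cases hw with ⟨hlt, -, hmem⟩ | ⟨y, -, hiy, hmin, -, hmem⟩ <;>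
        rw [hmem]
      · rintro (h | h)
        · exact (hlt _ h).not_gt i.lt_succ_self
        · omega
      · rintro (⟨h, hne⟩ | h)
        · exact hne (le_antisymm hiy (hmin _ h i.lt_succ_self))
        · omega

theorem mem_firstRow_of_succ_before {w : List ℕ} {i : ℕ} (hw : w.Nodup)
    (ha : ¬ Contains w [3, 2, 1]) (h : [i + 1, i] <+ w) : i ∈ firstRow w := by
  induction w using List.reverseRecOn with
  | nil => simp at h
  | append_singleton w x ih =>
    have haw : ¬ Contains w [3, 2, 1] :=
      fun ⟨u, hu, hred⟩ => ha ⟨u, hu.trans (List.sublist_append_left _ _), hred⟩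
    rcases pair_sublist_concat_iff.1 h with h | ⟨-, rfl⟩
    · have ih := ih hw.of_append_left haw h
      rcases firstRow_concat_cases hw with ⟨-, -, hmem⟩ | ⟨y, -, hxy, -, -, hmem⟩ <;> rw [hmem]
      · exact .inl ih
      · refine .inl ⟨ih, ?_⟩
        rintro rfl
        exact triplewise_iff_forall_sublist.1 (not_contains_321_iff.1 ha) (i + 1) i x
          (h.append (.refl [x])) ⟨hxy, i.lt_succ_self⟩
    · rcases firstRow_concat_cases hw with ⟨-, -, hmem⟩ | ⟨y, -, -, -, -, hmem⟩ <;> simp [hmem]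

theorem mem_firstRow_and_succ_notMem_iff {w : List ℕ} {i : ℕ} (hw : w.Nodup)
    (ha : ¬ Contains w [3, 2, 1]) (hi : i ∈ w) (hi' : i + 1 ∈ w) :
    i ∈ firstRow w ∧ i + 1 ∉ firstRow w ↔ [i + 1, i] <+ w := by
  refine ⟨fun ⟨h, h'⟩ => ?_, fun h => ⟨mem_firstRow_of_succ_before hw ha h,
    succ_notMem_firstRow hw h⟩⟩
  exact (pair_sublist_total hw hi' hi (by simp)).resolve_right
    fun hsub => h' (succ_mem_firstRow hw hsub h)

theorem increasingFrom_iff {w : List ℕ} {n k : ℕ} (hw : w ∈ S n) (hk : 1 ≤ k) :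
    IncreasingFrom k w ↔ ∀ i, k ≤ i → i < n → ¬ [i + 1, i] <+ w := by
  obtain ⟨hnodup, hmem⟩ := mem_S_iff.1 hw
  refine ⟨fun h i hki _ hsub => ?_, fun h => List.pairwise_iff_forall_sublist.2 fun {x y} hxy hky =>
    ?_⟩
  · exact i.lt_succ_self.not_ge (List.pairwise_iff_forall_sublist.1 h hsub hki)
  · by_contra! hyx
    have hmono (z : ℕ) (hyz : y ≤ z) : z ≤ n → w.idxOf y ≤ w.idxOf z := by
      induction z, hyz using Nat.le_induction with
      | base => exact fun _ => le_rfl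
      | succ z hyz ih =>
        refine fun hz => (ih (by omega)).trans (not_lt.1 fun hlt => h z (hky.trans hyz) hz ?_)
        exact (pair_sublist_iff_idxOf_lt hnodup).2 ⟨(hmem z).2 (by omega), hlt⟩
    exact ((pair_sublist_iff_idxOf_lt hnodup).1 hxy).2.not_ge
      (hmono x hyx.le ((hmem x).1 (hxy.subset (by simp))).2)

theorem inversion_of_mem_Av {n x y : ℕ} {u v t : List ℕ}
    (h : u ++ x :: (v ++ y :: t) ∈ Av n [3, 2, 1]) (hyx : y < x) :
    u.length + 1 < x ∧ y ≤ u.length + v.length + 1 := by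
  obtain ⟨hS, havoid⟩ := h
  have hno {z₁ z₂ z₃ : ℕ} (hsub : [z₁, z₂, z₃] <+ u ++ x :: (v ++ y :: t)) (h₁₂ : z₂ < z₁) :
      ¬ z₃ < z₂ := fun h₂₃ =>
    triplewise_iff_forall_sublist.1 (not_contains_321_iff.1 havoid) z₁ z₂ z₃ hsub ⟨h₂₃, h₁₂⟩
  obtain ⟨hnodup, hmem⟩ := mem_S_iff.1 hS
  have hu : u.countP (· < x) = u.length := by
    refine List.countP_eq_length.2 fun z hz => decide_eq_true ?_
    have hsub : [z, x, y] <+ u ++ x :: (v ++ y :: t) :=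
      (List.singleton_sublist.2 hz).append (.cons_cons x (by simp))
    have hzx : z ≠ x := (List.nodup_append.1 hnodup).2.2 z hz x (by simp)
    exact hzx.lt_or_gt.resolve_right fun hxz => hno hsub hxz hyx
  have ht : t.countP (· < y) = 0 := by
    refine List.countP_eq_zero.2 fun z hz hzy => ?_
    have hsub : [x, y, z] <+ u ++ x :: (v ++ y :: t) :=
      List.Sublist.trans (.cons_cons x ((List.Sublist.cons_cons y (by simpa)).trans
        (List.sublist_append_right v _))) (List.sublist_append_right u _)
    exact hno hsub hyx (of_decide_eq_true hzy)
  have hcount (a : ℕ) := (List.Perm.countP_eq (· < a) hS).trans (countP_lt_range' a n)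
  have hx := hcount x
  have hy := hcount y
  have hxn := (hmem x).1 (by simp)
  simp only [List.countP_append, List.countP_cons, hu, ht, hyx, lt_irrefl, hyx.not_gt, decide_true,
    decide_false, if_true, Bool.false_eq_true, if_false] at hx hy
  have := List.countP_le_length (p := (· < y)) (l := u)
  have := List.countP_le_length (p := (· < y)) (l := v)
  omega

theorem exists_eq_append_cons {α : Type*} {w : List α} {i : ℕ} (hi : i < w.length) :
    ∃ u x v, w = u ++ x :: v ∧ u.length = i :=
  ⟨w.take i, w[i], w.drop (i + 1), by simp, by simp [hi.le]⟩

theorem letter_lt_or_inversion {n a m : ℕ} {w : List ℕ} (hw : w ∈ Av n [3, 2, 1]) (ha : 1 ≤ a)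
    (ham : a < m) (hm : m ≤ n) :
    letter w a < letter w m ∨ letter w m < letter w a ∧ a < letter w a ∧ letter w m ≤ m := by
  have hl := length_of_mem_S hw.1
  obtain ⟨u, x, v, rfl, hu⟩ := exists_eq_append_cons (w := w) (i := a - 1) (by omega)
  obtain ⟨v, y, t, rfl, hv⟩ := exists_eq_append_cons (w := v) (i := m - a - 1)
    (by simp at hl; omega)
  obtain rfl : a = u.length + 1 := by omega
  obtain rfl : m = (u ++ x :: v).length + 1 := by simp; omega
  have hx : letter (u ++ x :: (v ++ y :: t)) (u.length + 1) = x := letter_append_cons ..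
  have hy : letter (u ++ x :: (v ++ y :: t)) ((u ++ x :: v).length + 1) = y := by
    simpa using letter_append_cons (u ++ x :: v) t y
  rw [hx, hy]
  have hxy : x ≠ y := by
    rintro rfl
    simpa [List.nodup_append] using (mem_S_iff.1 hw.1).1
  refine hxy.lt_or_gt.imp_right fun hyx => ⟨hyx, ?_⟩
  have := inversion_of_mem_Av hw hyx
  simp only [List.length_append, List.length_cons]
  omega

theorem map_letter_range' (w : List ℕ) : (List.range' 1 w.length).map (letter w) = w := by
  refine List.ext_getElem (by simp) fun i h _ => ?_
  simp [letter, (by simpa using h : i < w.length)]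

theorem matchLoop_of_forall_lt (w : List ℕ) {es : List ℕ} {a : ℕ} (as : List ℕ)
    (h : ∀ e ∈ es, a < e) : matchLoop w es (a :: as) = matchLoop w es as := by
  rcases es with _ | ⟨e, es⟩
  · simp only [matchLoop]
  · rw [matchLoop, if_pos (h e (by simp))]

theorem matchLoop_append_of_forall_lt {w q : List ℕ} {a : ℕ} (es as : List ℕ)
    (h : ∀ e ∈ q, e < a ∧ letter w e < letter w a) :
    matchLoop w (q ++ es) (a :: as) = matchLoop w es (a :: as) := by
  induction q with
  | nil => rfl
  | cons e q ih =>
    obtain ⟨⟨hea, hlt⟩, hq⟩ := List.forall_mem_cons.1 h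
    rw [List.cons_append, matchLoop, if_neg hea.not_gt, if_pos hlt, ih hq]

/- A row holding the values of the queue `q` of passed unmatched excedances, and smaller letters
`r`, changes under insertion of a non-excedance value as the queue does under the matching loop. -/
theorem exists_matchLoop_cons {w q r es as : List ℕ} {m : ℕ}
    (hq : ∀ e ∈ q, e < m ∧ letter w e ≠ letter w m) (hr : ∀ y ∈ r, y ≤ letter w m)
    (hes : ∀ e ∈ es, m < e) :
    ∃ q₁ r₁, q₁ <+ q ∧ (∀ y ∈ r₁, y ≤ letter w m) ∧
      (rowInsert (letter w m) (r ++ q.map (letter w))).1 = r₁ ++ q₁.map (letter w) ∧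
      (matchLoop w (q ++ es) (m :: as)).map Prod.fst =
        (rowInsert (letter w m) (r ++ q.map (letter w))).2.toList ++
          (matchLoop w (q₁ ++ es) as).map Prod.fst := by
  have hle {q₀ : List ℕ} (hlt : ∀ e ∈ q₀, letter w e < letter w m) :
      ∀ y ∈ r ++ q₀.map (letter w), y ≤ letter w m := by
    simpa [or_imp, forall_and] using ⟨hr, fun e he => (hlt e he).le⟩
  rcases forall_mem_or_exists_first_not (fun e => letter w e < letter w m) q with
    hlt | ⟨q₀, e, q₁, rfl, hlt, he⟩
  · refine ⟨[], r ++ q.map (letter w) ++ [letter w m], List.nil_sublist q, ?_, ?_, ?_⟩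
    · exact List.forall_mem_append.2 ⟨hle hlt, by simp⟩
    · simp [rowInsert_of_forall_le (hle hlt)]
    · rw [matchLoop_append_of_forall_lt _ _ fun e he => ⟨(hq e he).1, hlt e he⟩,
        matchLoop_of_forall_lt _ _ hes, rowInsert_of_forall_le (hle hlt)]
      rfl
  · obtain ⟨hem, hne⟩ := hq e (by simp)
    have hins : rowInsert (letter w m) (r ++ (q₀ ++ e :: q₁).map (letter w)) =
        (r ++ q₀.map (letter w) ++ letter w m :: q₁.map (letter w), some (letter w e)) := by
      rw [List.map_append, List.map_cons, ← List.append_assoc]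
      exact rowInsert_append_cons (hle hlt) (hne.lt_of_le' (not_lt.1 he))
    refine ⟨q₁, r ++ q₀.map (letter w) ++ [letter w m], by simp, ?_, ?_, ?_⟩
    · exact List.forall_mem_append.2 ⟨hle hlt, by simp⟩
    · rw [hins]
      simp
    · rw [List.append_assoc, List.cons_append, matchLoop_append_of_forall_lt _ _ fun a ha =>
        ⟨(hq a (by simp [ha])).1, hlt a ha⟩, matchLoop, if_neg hem.not_gt, if_neg he, hins]
      rfl

theorem map_fst_matchLoop {w ps q r : List ℕ}
    (hpw : (q ++ ps).Pairwise fun a m => a < m ∧ (letter w a < letter w m ∨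
      letter w m < letter w a ∧ a < letter w a ∧ letter w m ≤ m))
    (hr : ∀ y ∈ r, ∀ m ∈ ps, y < letter w m) :
    (matchLoop w (q ++ ps.filter fun i => i < letter w i)
      (ps.filter fun i => letter w i ≤ i)).map Prod.fst =
    bumpedFrom (r ++ q.map (letter w)) (ps.map (letter w)) := by
  induction ps generalizing q r with
  | nil => cases q <;> simp [matchLoop, bumpedFrom]
  | cons m ps ih =>
    obtain ⟨-, hmps, hqm⟩ := List.pairwise_append.1 hpw
    have hm := (List.pairwise_cons.1 hmps).1
    have hrm : ∀ y ∈ r, y ≤ letter w m := fun y hy => (hr y hy m (by simp)).le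
    by_cases hexc : m < letter w m
    · have hle : ∀ y ∈ r ++ q.map (letter w), y ≤ letter w m := by
        have hqm : ∀ e ∈ q, letter w e ≤ letter w m := fun e he => by
          have := hqm e he m (by simp)
          omega
        simpa [or_imp, forall_and] using ⟨hrm, hqm⟩
      simpa [hexc, hexc.not_ge, bumpedFrom, rowInsert_of_forall_le hle] using
        ih (q := q ++ [m]) (by simpa using hpw) fun y hy a ha => hr y hy a (by simp [ha])
    · have hqm : ∀ e ∈ q, e < m ∧ letter w e ≠ letter w m := fun e he => by
        have := hqm e he m (by simp)
        omega
      obtain ⟨q₁, r₁, hsub, hr₁, hrow, hmatch⟩ := exists_matchLoop_cons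
        (as := ps.filter fun i => letter w i ≤ i) hqm hrm
        fun e (he : e ∈ ps.filter fun i => i < letter w i) => (hm e (List.mem_of_mem_filter he)).1
      rw [List.filter_cons_of_neg (by simpa using hexc),
        List.filter_cons_of_pos (by simpa using hexc), List.map_cons, bumpedFrom, hrow, hmatch,
        ih (hpw.sublist (hsub.append (List.sublist_cons_self m ps))) fun y hy a ha => ?_]
      have := hm a ha
      have := hr₁ y hy
      omega

theorem map_fst_matching {n : ℕ} {w : List ℕ} (hw : w ∈ Av n [3, 2, 1]) :
    (matching w).map Prod.fst = bumpedFrom [] w := by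
  have hpw : (List.range' 1 w.length).Pairwise fun a m => a < m ∧ (letter w a < letter w m ∨
      letter w m < letter w a ∧ a < letter w a ∧ letter w m ≤ m) := by
    refine List.Pairwise.imp_of_mem (fun {a m} ha hm ham => ⟨ham, ?_⟩) List.pairwise_lt_range'
    rw [length_of_mem_S hw.1, List.mem_range'_1] at ha hm
    exact letter_lt_or_inversion hw ha.1 ham (by omega)
  simpa [map_letter_range', matching, excedances, nonExcedances] using
    map_fst_matchLoop (q := []) (r := []) hpw (by simp)

theorem matchedBelow_eq_countP {n k : ℕ} {w : List ℕ} (hw : w ∈ Av n [3, 2, 1]) (hk : k ≤ n + 1) :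
    matchedBelow w k = (List.range' 1 (k - 1)).countP (· ∉ firstRow w) := by
  obtain ⟨hnodup, hmem⟩ := mem_S_iff.1 hw.1
  have hperm := bumpedFrom_append_firstRow_perm w
  obtain ⟨hbumped, -, hdisj⟩ := List.nodup_append.1 (hperm.nodup_iff.2 hnodup)
  have hcount : matchedBelow w k = (bumpedFrom [] w).countP (· < k) := by
    rw [← map_fst_matching hw, List.countP_map]
    rfl
  rw [hcount, List.countP_eq_length_filter, List.countP_eq_length_filter]
  refine List.Perm.length_eq ((List.perm_ext_iff_of_nodup (hbumped.filter _)
    (List.Nodup.filter _ (List.nodup_range' ..))).2 fun i => ?_)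
  have hi : i ∈ bumpedFrom [] w ∨ i ∈ firstRow w ↔ 1 ≤ i ∧ i ≤ n := by
    rw [← List.mem_append, hperm.mem_iff, hmem]
  have hi' : i ∈ bumpedFrom [] w → i ∉ firstRow w := fun h h' => hdisj i h i h' rfl
  simp only [List.mem_filter, List.mem_range'_1, decide_eq_true_eq]
  constructor
  · rintro ⟨hb, hik⟩
    have := hi.1 (.inl hb)
    exact ⟨by omega, hi' hb⟩
  · rintro ⟨hik, hrow⟩
    exact ⟨(hi.2 (by omega)).resolve_right hrow, by omega⟩

open DyckStep

theorem exists_firstRow_threshold {n k : ℕ} {w : List ℕ} (hw : w ∈ Av n [3, 2, 1]) (h₁ : 1 ≤ k)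
    (h₂ : k ≤ n + 1) (hinc : IncreasingFrom k w) :
    ∃ y, k ≤ y ∧ y ≤ n + 1 ∧ ∀ m, k ≤ m → (m ∈ firstRow w ↔ y ≤ m ∧ m ≤ n) := by
  classical
  obtain ⟨hnodup, hmem⟩ := mem_S_iff.1 hw.1
  have hup (i : ℕ) (hki : k ≤ i) (hin : i < n) (hi : i ∈ firstRow w) : i + 1 ∈ firstRow w := by
    by_contra hi'
    exact (increasingFrom_iff hw.1 h₁).1 hinc i hki hin <|
      (mem_firstRow_and_succ_notMem_iff hnodup hw.2 ((hmem i).2 (by omega))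
        ((hmem _).2 (by omega))).1 ⟨hi, hi'⟩
  have hex : ∃ y, k ≤ y ∧ (y ∈ firstRow w ∨ y = n + 1) := ⟨n + 1, h₂, .inr rfl⟩
  obtain ⟨hky, hy⟩ := Nat.find_spec hex
  have hle : Nat.find hex ≤ n + 1 := Nat.find_min' hex ⟨h₂, .inr rfl⟩
  refine ⟨Nat.find hex, hky, hle, fun m hkm => ⟨fun hm => ⟨Nat.find_min' hex ⟨hkm, .inl hm⟩,
    ((hmem m).1 (mem_of_mem_firstRow hm)).2⟩, fun h => ?_⟩⟩
  induction m, h.1 using Nat.le_induction with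
  | base => exact hy.resolve_right (by omega)
  | succ m hym ih => exact hup m (by omega) h.2 (ih (by omega) ⟨hym, by omega⟩)

theorem mem_map_shiftLetter {k m : ℕ} {r : List ℕ} :
    m ∈ r.map (shiftLetter k) ↔ m < k ∧ m ∈ r ∨ k < m ∧ m - 1 ∈ r := by
  rw [List.mem_map]
  constructor
  · rintro ⟨x, hx, rfl⟩
    rcases lt_or_ge x k with h | h
    · rw [shiftLetter_of_lt h]
      exact .inl ⟨h, hx⟩
    · rw [shiftLetter_of_le h]
      exact .inr ⟨by omega, hx⟩
  · rintro (⟨h, hm⟩ | ⟨h, hm⟩)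
    · exact ⟨m, hm, shiftLetter_of_lt h⟩
    · exact ⟨m - 1, hm, by rw [shiftLetter_of_le (by omega)]; omega⟩

theorem firstRow_map_shiftLetter_concat {n k y : ℕ} {w : List ℕ} (hw : w.Nodup) (hky : k ≤ y)
    (hyn : y ≤ n + 1) (hy : ∀ m, k ≤ m → (m ∈ firstRow w ↔ y ≤ m ∧ m ≤ n)) :
    ((rowInsert k (firstRow (w.map (shiftLetter k)))).2 = none ↔ y = n + 1) ∧
    ∀ i, i ∈ firstRow (w.map (shiftLetter k) ++ [k]) ↔
      i < k ∧ i ∈ firstRow w ∨ i = k ∨ y + 2 ≤ i ∧ i ≤ n + 1 := by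
  have hnodup : (w.map (shiftLetter k) ++ [k]).Nodup :=
    (List.perm_append_singleton k _).nodup_iff.2 <| List.nodup_cons.2
      ⟨by simp [shiftLetter_ne], hw.map (shiftLetter_strictMono k).injective⟩
  have hrow (m : ℕ) : m ∈ firstRow (w.map (shiftLetter k)) ↔
      m < k ∧ m ∈ firstRow w ∨ y + 1 ≤ m ∧ m ≤ n + 1 := by
    rw [firstRow_map (shiftLetter_strictMono k), mem_map_shiftLetter]
    refine or_congr_right ⟨fun ⟨_, hm⟩ => ?_, fun h => ⟨by omega, (hy _ (by omega)).2 (by omega)⟩⟩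
    have := (hy _ (by omega)).1 hm
    omega
  rcases firstRow_concat_cases hnodup with ⟨hlt, hbump, hmem⟩ | ⟨z, hz, hkz, hmin, hbump, hmem⟩
  · have hyn : y = n + 1 := by
      by_contra hne
      have := hlt (y + 1) ((hrow _).2 (by omega))
      omega
    refine ⟨iff_of_true hbump hyn, fun i => ?_⟩
    rw [hmem, hrow]
    grind
  · have hz' := (hrow z).1 hz
    obtain rfl : z = y + 1 := le_antisymm (hmin _ ((hrow _).2 (by omega)) (by omega)) (by omega)
    refine ⟨iff_of_false hbump (by omega), fun i => ?_⟩
    rw [hmem, hrow]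
    grind

/-- The left half of the path `Ψ`. -/
def leftHalf (w : List ℕ) : List DyckStep :=
  (List.range' 1 w.length).map fun i => if i ∈ firstRow w then U else D

/-- The right half of the path `Ψ`. -/
def rightHalf (w : List ℕ) : List DyckStep :=
  (List.range' 1 w.length).reverse.map fun i => if i ∈ recRow w then D else U

theorem Psi_eq (w : List ℕ) : Psi w = leftHalf w ++ rightHalf w := rfl

theorem length_leftHalf (w : List ℕ) : (leftHalf w).length = w.length := by simp [leftHalf]

theorem length_Psi (w : List ℕ) : (Psi w).length = w.length + w.length := by
  simp [Psi_eq, leftHalf, rightHalf]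

theorem rightHalf_concat (w : List ℕ) (x : ℕ) :
    rightHalf (w ++ [x]) =
      (if (rowInsert x (firstRow w)).2 = none then D else U) :: rightHalf w := by
  have hnotMem : w.length + 1 ∉ recRow w := fun h => (mem_recRow_le h).not_gt (Nat.lt_succ_self _)
  unfold rightHalf
  rw [recRow_concat, List.length_append, List.length_singleton, List.range'_1_concat,
    List.reverse_append, List.reverse_singleton, List.singleton_append, List.map_cons,
    Nat.add_comm 1]
  congr 1
  · split_ifs <;> simp_all
  · refine List.map_congr_left fun i hi => ?_
    have hne : i ≠ w.length + 1 := by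
      rw [List.mem_reverse, List.mem_range'_1] at hi
      omega
    split_ifs <;> simp_all

theorem rightHalf_map {f : ℕ → ℕ} (hf : StrictMono f) (w : List ℕ) :
    rightHalf (w.map f) = rightHalf w := by
  rw [rightHalf, rightHalf, recRow_map hf, List.length_map]

theorem leftHalf_concat_eq_map {k y : ℕ} {w : List ℕ} (hw : w.Nodup) (hky : k ≤ y)
    (hyn : y ≤ w.length + 1) (hy : ∀ m, k ≤ m → (m ∈ firstRow w ↔ y ≤ m ∧ m ≤ w.length)) :
    leftHalf (w.map (shiftLetter k) ++ [k]) ++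
      [if (rowInsert k (firstRow (w.map (shiftLetter k)))).2 = none then D else U] =
    (List.range' 1 (w.length + 2)).map fun i =>
      if i < k ∧ i ∈ firstRow w ∨ i = k ∨ y + 2 ≤ i then U else D := by
  obtain ⟨hnone, hmem⟩ := firstRow_map_shiftLetter_concat hw hky hyn hy
  rw [List.range'_1_concat, List.map_append, leftHalf, List.length_append, List.length_map]
  congr 1
  · refine List.map_congr_left fun i hi => if_congr ((hmem i).trans ?_) rfl rfl
    rw [List.length_singleton, List.mem_range'_1] at hi
    simp [show i ≤ w.length + 1 by omega]
  · simp only [hnone, List.map_cons, List.map_nil]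
    grind

theorem leftHalf_concat {n k : ℕ} {w : List ℕ} (hw : w ∈ Av n [3, 2, 1]) (h₁ : 1 ≤ k)
    (h₂ : k ≤ n + 1) (hinc : IncreasingFrom k w) :
    leftHalf (w.map (shiftLetter k) ++ [k]) ++
      [if (rowInsert k (firstRow (w.map (shiftLetter k)))).2 = none then D else U] =
      (leftHalf w).take (k - 1) ++ U :: D :: (leftHalf w).drop (k - 1) := by
  obtain ⟨y, hky, hyn, hy⟩ := exists_firstRow_threshold hw h₁ h₂ hinc
  obtain rfl := length_of_mem_S hw.1
  rw [leftHalf_concat_eq_map (mem_S_iff.1 hw.1).1 hky hyn hy]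
  obtain ⟨a, rfl⟩ := Nat.exists_eq_add_of_le' h₁
  obtain ⟨d, hd⟩ := Nat.exists_eq_add_of_le (Nat.le_of_succ_le_succ h₂)
  set f : ℕ → DyckStep := fun i => if i ∈ firstRow w then U else D
  set g : ℕ → DyckStep := fun i =>
    if i < a + 1 ∧ i ∈ firstRow w ∨ i = a + 1 ∨ y + 2 ≤ i then U else D
  have hleft : leftHalf w = (List.range' 1 a).map f ++ (List.range' (a + 1) d).map f := by
    rw [leftHalf, hd, ← List.range'_append_1, List.map_append, Nat.add_comm 1]
  have hbefore : (List.range' 1 a).map g = (List.range' 1 a).map f :=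
    List.map_congr_left fun i hi => if_congr (by grind) rfl rfl
  have hafter : (List.range' (a + 1 + 1 + 1) d).map g = (List.range' (a + 1) d).map f := by
    rw [show a + 1 + 1 + 1 = 2 + (a + 1) by omega, ← List.map_add_range', List.map_map]
    refine List.map_congr_left fun i hi => if_congr ?_ rfl rfl
    rw [List.mem_range'_1] at hi
    rw [hy i hi.1]
    dsimp only
    omega
  have hpeak : g (a + 1) = U := if_pos (.inr (.inl rfl))
  have hvalley : g (a + 1 + 1) = D := if_neg (by omega)
  rw [hleft, hd, Nat.add_assoc, ← List.range'_append_1, List.map_append, hbefore, Nat.add_comm 1,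
    List.range'_succ, List.range'_succ, List.map_cons, List.map_cons, hafter, hpeak, hvalley,
    Nat.add_sub_cancel, List.take_left' (by simp), List.drop_left' (by simp)]

theorem Psi_ins {n k : ℕ} {w : List ℕ} (hw : w ∈ Av n [3, 2, 1]) (h₁ : 1 ≤ k) (h₂ : k ≤ n + 1)
    (hinc : IncreasingFrom k w) :
    Psi (ins w (n + 1) k) = (Psi w).take (k - 1) ++ U :: D :: (Psi w).drop (k - 1) := by
  have hl := length_of_mem_S hw.1
  have hL := length_leftHalf w
  rw [ins_length_add_one hl, Psi_eq, Psi_eq, rightHalf_concat,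
    rightHalf_map (shiftLetter_strictMono k), List.take_append_of_le_length (by omega),
    List.drop_append_of_le_length (by omega), List.append_cons, leftHalf_concat hw h₁ h₂ hinc]
  simp

theorem getElem?_Psi {i : ℕ} {w : List ℕ} (hi : i < w.length) :
    (Psi w)[i]? = some (if i + 1 ∈ firstRow w then U else D) := by
  rw [Psi_eq, List.getElem?_append_left (by rwa [length_leftHalf])]
  simp [leftHalf, hi, Nat.add_comm]

theorem count_D_take_Psi {n k : ℕ} {w : List ℕ} (hw : w ∈ Av n [3, 2, 1]) (hk : k ≤ n + 1) :
    ((Psi w).take (k - 1)).count D = matchedBelow w k := by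
  have hl := length_of_mem_S hw.1
  rw [matchedBelow_eq_countP hw hk, Psi_eq,
    List.take_append_of_le_length (by rw [length_leftHalf]; omega), leftHalf, ← List.map_take,
    List.take_range'_of_length_ge (by omega), List.count, List.countP_map]
  refine List.countP_congr fun i _ => ?_
  by_cases h : i ∈ firstRow w <;> simp [h]

theorem matchedBelow_ins {n k : ℕ} {w : List ℕ} (hw : w ∈ Av n [3, 2, 1]) (h₁ : 1 ≤ k)
    (h₂ : k ≤ n + 1) (hinc : IncreasingFrom k w) :
    matchedBelow (ins w (n + 1) k) k = matchedBelow w k := by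
  have hl := length_Psi w
  rw [length_of_mem_S hw.1] at hl
  rw [← count_D_take_Psi hw h₂,
    ← count_D_take_Psi ((ins_last_mem_Av_iff h₁ h₂).2 ⟨hw, hinc⟩) (by omega),
    Psi_ins hw h₁ h₂ hinc, List.take_append_of_le_length (by simp [hl]; omega), List.take_take,
    min_self]

theorem append_eq_append_cons_iff {α : Type*} {X Y A R : List α} {a : α} :
    X ++ Y = A ++ a :: R ↔
      (∃ T, A = X ++ T ∧ Y = T ++ a :: R) ∨ ∃ T, X = A ++ a :: T ∧ R = T ++ Y := by
  constructor
  · intro h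
    rcases List.append_eq_append_iff.1 h with ⟨T, hA, hY⟩ | ⟨_ | ⟨b, T⟩, hX, hR⟩
    · exact .inl ⟨T, hA, hY⟩
    · exact .inl ⟨[], by simpa using hX.symm, by simpa using hR.symm⟩
    · obtain ⟨rfl, rfl⟩ := List.cons.inj hR
      exact .inr ⟨T, hX, rfl⟩
  · rintro (⟨T, rfl, rfl⟩ | ⟨T, rfl, rfl⟩) <;> simp

theorem count_U_add_count_D (w : List DyckStep) : w.count U + w.count D = w.length := by
  induction w with
  | nil => rfl
  | cons a w ih => cases a <;> simp <;> omega

theorem isDyck_iff {w : List DyckStep} :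
    IsDyck w ↔ w.count U = w.count D ∧ ∀ A C, A ++ C = w → A.count D ≤ A.count U := by
  constructor
  · rintro ⟨p, rfl⟩
    refine ⟨p.count_U_eq_count_D, fun A C h => ?_⟩
    simpa [← h] using p.count_D_le_count_U A.length
  · rintro ⟨hcount, hprefix⟩
    exact ⟨⟨w, hcount, fun i => hprefix _ _ (List.take_append_drop i w)⟩, rfl⟩

theorem IsDyck.count_U_eq_count_D {w : List DyckStep} (hw : IsDyck w) : w.count U = w.count D :=
  (isDyck_iff.1 hw).1

theorem IsDyck.count_D_le_count_U {A C : List DyckStep} (hw : IsDyck (A ++ C)) :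
    A.count D ≤ A.count U :=
  (isDyck_iff.1 hw).2 A C rfl

theorem isDyck_nil : IsDyck [] := ⟨0, rfl⟩

theorem IsDyck.eq_nil {w : List DyckStep} (hw : IsDyck w) (h : w.count U = 0) : w = [] := by
  rw [← List.length_eq_zero_iff, ← count_U_add_count_D, ← hw.count_U_eq_count_D, h]

theorem IsDyck.nest {B C : List DyckStep} (hB : IsDyck B) (hC : IsDyck C) :
    IsDyck (U :: (B ++ D :: C)) := by
  obtain ⟨p, rfl⟩ := hB
  obtain ⟨q, rfl⟩ := hC
  exact ⟨p.nest + q, congrArg (U :: ·) (List.append_assoc _ [D] _)⟩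

@[elab_as_elim]
theorem IsDyck.induction {P : (w : List DyckStep) → IsDyck w → Prop} (nil : P [] isDyck_nil)
    (nest : ∀ B C (hB : IsDyck B) (hC : IsDyck C), P B hB → P C hC →
      P (U :: (B ++ D :: C)) (hB.nest hC))
    {w : List DyckStep} (hw : IsDyck w) : P w hw := by
  obtain ⟨p, rfl⟩ := hw
  induction hp : p.semilength using Nat.strong_induction_on generalizing p with
  | h n ih =>
    obtain rfl | hne := eq_or_ne p 0
    · exact nil
    · have hsplit : p.toList = U :: (p.insidePart.toList ++ D :: p.outsidePart.toList) := by
        conv_lhs => rw [← DyckWord.nest_insidePart_add_outsidePart hne]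
        exact congrArg (U :: ·) (List.append_assoc _ [D] _)
      simp only [hsplit]
      exact nest _ _ _ _ (ih _ (hp ▸ DyckWord.semilength_insidePart_lt hne) _ rfl)
        (ih _ (hp ▸ DyckWord.semilength_outsidePart_lt hne) _ rfl)

theorem isDyck_insert_iff {X W Y : List DyckStep} (hW : IsDyck W) :
    IsDyck (X ++ (W ++ Y)) ↔ IsDyck (X ++ Y) := by
  have hcount := hW.count_U_eq_count_D
  refine ⟨fun h => isDyck_iff.2 ⟨?_, fun A C hAC => ?_⟩,
    fun h => isDyck_iff.2 ⟨?_, fun A C hAC => ?_⟩⟩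
  · have := h.count_U_eq_count_D
    simp only [List.count_append] at this ⊢
    omega
  · rcases List.append_eq_append_iff.1 hAC with ⟨T, rfl, rfl⟩ | ⟨T, rfl, rfl⟩
    · rw [List.append_assoc] at h
      exact h.count_D_le_count_U
    · rw [← List.append_assoc, ← List.append_assoc] at h
      have := h.count_D_le_count_U
      simp only [List.count_append] at this ⊢
      omega
  · have := h.count_U_eq_count_D
    simp only [List.count_append] at this ⊢
    omega
  · rcases List.append_eq_append_iff.1 hAC with ⟨T, rfl, rfl⟩ | ⟨T, rfl, hT⟩
    · rw [List.append_assoc] at h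
      exact h.count_D_le_count_U
    have hX := h.count_D_le_count_U
    rcases List.append_eq_append_iff.1 hT with ⟨V, rfl, rfl⟩ | ⟨V, rfl, rfl⟩
    · rw [← List.append_assoc] at h
      have := h.count_D_le_count_U
      simp only [List.count_append] at this ⊢
      omega
    · have := hW.count_D_le_count_U
      simp only [List.count_append]
      omega

theorem isDyck_peak_iff {X Y : List DyckStep} : IsDyck (X ++ U :: D :: Y) ↔ IsDyck (X ++ Y) :=
  isDyck_insert_iff (W := [U, D]) (isDyck_nil.nest isDyck_nil)

theorem prefix_of_count_U_le {A A' R R' : List DyckStep} (h : A ++ R = A' ++ U :: R')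
    (hc : A.count U ≤ A'.count U) : A <+: A' := by
  rcases append_eq_append_cons_iff.1 h with ⟨T, rfl, -⟩ | ⟨T, rfl, -⟩
  · exact List.prefix_append A T
  · simp at hc

theorem IsDyck.prefix {B B' C C' : List DyckStep} (hB : IsDyck B) (hB' : IsDyck B')
    (h : B ++ C = B' ++ D :: C') : B <+: B' := by
  rcases append_eq_append_cons_iff.1 h with ⟨T, rfl, -⟩ | ⟨T, rfl, -⟩
  · exact List.prefix_append B T
  · rw [List.append_cons] at hB
    have hle := hB.count_D_le_count_U
    have heq := hB'.count_U_eq_count_D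
    simp at hle
    omega

theorem IsTunnel.unique {w : List DyckStep} {i j j' : ℕ} (h : IsTunnel w i j)
    (h' : IsTunnel w i j') : j = j' := by
  obtain ⟨A, B, C, rfl, hB, -, rfl, rfl⟩ := h
  obtain ⟨A', B', C', hw, hB', -, hi, rfl⟩ := h'
  obtain rfl : A = A' := (prefix_of_count_U_le hw (by omega)).sublist.antisymm
    (prefix_of_count_U_le hw.symm (by omega)).sublist
  obtain ⟨-, hR⟩ := List.cons.inj (List.append_cancel_left hw)
  obtain rfl : B = B' := (hB.prefix hB' hR).sublist.antisymm (hB'.prefix hB hR.symm).sublist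
  rfl

theorem isTunnel_nest {B C : List DyckStep} (hB : IsDyck B) (hC : IsDyck C) :
    IsTunnel (U :: (B ++ D :: C)) 1 (B.count U + 1) :=
  ⟨[], B, C, rfl, hB, hC, rfl, by rw [hB.count_U_eq_count_D]; rfl⟩

theorem isTunnel_peak {X Y : List DyckStep} (h : IsDyck (X ++ Y)) :
    IsTunnel (X ++ U :: D :: Y) (X.count U + 1) (X.count D + 1) :=
  ⟨X, [], Y, rfl, isDyck_nil, h, rfl, by simp⟩

theorem IsTunnel.append_append {W X Y : List DyckStep} {i j : ℕ} (h : IsTunnel W i j)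
    (hXY : IsDyck (X ++ Y)) : IsTunnel (X ++ (W ++ Y)) (X.count U + i) (X.count D + j) := by
  obtain ⟨A, B, C, rfl, hB, hAC, rfl, rfl⟩ := h
  refine ⟨X ++ A, B, C ++ Y, by simp, hB, ?_, by simp [Nat.add_assoc], by simp [Nat.add_assoc]⟩
  simpa using (isDyck_insert_iff hAC).2 hXY

theorem IsTunnel.insert_peak {X Y : List DyckStep} {i j : ℕ} (h : IsTunnel (X ++ Y) i j) :
    IsTunnel (X ++ U :: D :: Y) (shiftLetter (X.count U + 1) i)
      (shiftLetter (X.count D + 1) j) := by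
  obtain ⟨A, B, C, hw, hB, hAC, rfl, rfl⟩ := h
  rcases append_eq_append_cons_iff.1 hw with ⟨T, rfl, rfl⟩ | ⟨T, rfl, hT⟩
  · rw [List.append_assoc] at hAC
    refine ⟨X ++ U :: D :: T, B, C, by simp, hB, by simpa using isDyck_peak_iff.2 hAC, ?_, ?_⟩ <;>
    · rw [shiftLetter_of_le (by simp)]
      simp
      omega
  rcases append_eq_append_cons_iff.1 hT.symm with ⟨V, rfl, rfl⟩ | ⟨V, rfl, rfl⟩
  · refine ⟨A, T ++ U :: D :: V, C, by simp, isDyck_peak_iff.2 hB, hAC, ?_, ?_⟩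
    · exact shiftLetter_of_lt (by simp)
    · rw [shiftLetter_of_le (by simp)]
      simp
      omega
  · rw [← List.append_assoc] at hAC
    refine ⟨A, B, V ++ U :: D :: Y, by simp, hB, by simpa using isDyck_peak_iff.2 hAC, ?_, ?_⟩
    · exact shiftLetter_of_lt (by simp)
    · exact shiftLetter_of_lt (by simp)

/-- The number of the down-step at which the tunnel from the `i`-th up-step ends (`0` if there is
no such tunnel). -/
noncomputable def tunnelEnd (w : List DyckStep) (i : ℕ) : ℕ := sInf {j | IsTunnel w i j}

theorem IsTunnel.tunnelEnd_eq {w : List DyckStep} {i j : ℕ} (h : IsTunnel w i j) :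
    tunnelEnd w i = j := by
  have hset : {j | IsTunnel w i j} = {j} :=
    Set.eq_singleton_iff_unique_mem.2 ⟨h, fun _ h' => IsTunnel.unique h' h⟩
  rw [tunnelEnd, hset, csInf_singleton]

theorem PhiInv_eq_map_tunnelEnd (w : List DyckStep) :
    PhiInv w = (List.range' 1 (w.count U)).map fun a => tunnelEnd w (w.count U + 1 - a) := rfl

theorem length_PhiInv (w : List DyckStep) : (PhiInv w).length = w.count U := by
  simp [PhiInv_eq_map_tunnelEnd]

theorem letter_PhiInv {w : List DyckStep} {a : ℕ} (h₁ : 1 ≤ a) (h₂ : a ≤ w.count U) :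
    letter (PhiInv w) a = tunnelEnd w (w.count U + 1 - a) := by
  have hlt : a - 1 < w.count U := by omega
  simp [letter, PhiInv_eq_map_tunnelEnd, hlt, Nat.add_sub_cancel' h₁]

theorem IsTunnel.nest_inside {B C : List DyckStep} {i j : ℕ} (h : IsTunnel B i j)
    (hC : IsDyck C) : IsTunnel (U :: (B ++ D :: C)) (1 + i) j := by
  simpa using h.append_append (X := [U]) (Y := D :: C) (isDyck_peak_iff (X := []).2 hC)

theorem IsTunnel.nest_outside {B C : List DyckStep} {i j : ℕ} (hB : IsDyck B)
    (h : IsTunnel C i j) :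
    IsTunnel (U :: (B ++ D :: C)) (B.count U + 1 + i) (B.count U + 1 + j) := by
  have hUBD : IsDyck (U :: (B ++ [D])) := hB.nest isDyck_nil
  have h' := h.append_append (X := U :: (B ++ [D])) (Y := []) (by simpa using hUBD)
  simpa [hB.count_U_eq_count_D] using h'

theorem exists_isTunnel {w : List DyckStep} (hw : IsDyck w) :
    ∀ i, 1 ≤ i → i ≤ w.count U → ∃ j, IsTunnel w i j := by
  induction hw using IsDyck.induction with
  | nil => exact fun i h₁ h₂ => absurd (h₁.trans h₂) (by simp)
  | nest B C hB hC ihB ihC =>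
    intro i h₁ h₂
    simp only [List.count_cons_self, List.count_append, reduceCtorEq, List.count_cons,
      beq_iff_eq, if_false, Nat.add_zero] at h₂
    rcases h₁.eq_or_lt with rfl | hi
    · exact ⟨_, isTunnel_nest hB hC⟩
    rcases le_or_gt i (B.count U + 1) with hiB | hiB
    · obtain ⟨i, rfl⟩ := Nat.exists_eq_add_of_le hi.le
      obtain ⟨j, hj⟩ := ihB i (by omega) (by omega)
      exact ⟨_, hj.nest_inside hC⟩
    · obtain ⟨i, rfl⟩ := Nat.exists_eq_add_of_le hiB.le
      obtain ⟨j, hj⟩ := ihC i (by omega) (by omega)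
      exact ⟨_, hj.nest_outside hB⟩

theorem IsDyck.isTunnel_tunnelEnd {w : List DyckStep} {i : ℕ} (hw : IsDyck w) (h₁ : 1 ≤ i)
    (h₂ : i ≤ w.count U) : IsTunnel w i (tunnelEnd w i) := by
  obtain ⟨j, hj⟩ := exists_isTunnel hw i h₁ h₂
  rwa [hj.tunnelEnd_eq]

theorem PhiInv_nest {B C : List DyckStep} (hB : IsDyck B) (hC : IsDyck C) :
    PhiInv (U :: (B ++ D :: C)) =
      (PhiInv C).map (B.count U + 1 + ·) ++ (PhiInv B ++ [B.count U + 1]) := by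
  have hcount : (U :: (B ++ D :: C)).count U = C.count U + (B.count U + 1) := by
    simp
    omega
  simp only [PhiInv_eq_map_tunnelEnd, hcount]
  rw [← List.range'_append_1, List.map_append, List.map_map, List.range'_concat,
    List.map_append, List.map_singleton, Nat.one_mul, Nat.add_comm 1 (C.count U),
    ← List.map_add_range', List.map_map]
  refine congrArg₂ (· ++ ·) (List.map_congr_left fun a ha => ?_)
    (congrArg₂ (· ++ ·) (List.map_congr_left fun a ha => ?_) (congrArg ([·]) ?_))
  · rw [List.mem_range'_1] at ha
    have htunnel := hC.isTunnel_tunnelEnd (i := C.count U + 1 - a) (by omega) (by omega)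
    rw [Function.comp_apply, ← (htunnel.nest_outside hB).tunnelEnd_eq]
    congr 1
    omega
  · rw [List.mem_range'_1] at ha
    have htunnel := hB.isTunnel_tunnelEnd (i := B.count U + 1 - a) (by omega) (by omega)
    rw [← (htunnel.nest_inside hC).tunnelEnd_eq, Function.comp_apply]
    congr 1
    omega
  · exact (congrArg _ (by omega)).trans (isTunnel_nest hB hC).tunnelEnd_eq

theorem PhiInv_peak {X Y : List DyckStep} (h : IsDyck (X ++ Y)) :
    PhiInv (X ++ U :: D :: Y) = ins (PhiInv (X ++ Y)) (Y.count U + 1) (X.count D + 1) := by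
  have hcount : (X ++ Y).count U = Y.count U + X.count U := by
    rw [List.count_append, Nat.add_comm]
  have hcount' : (X ++ U :: D :: Y).count U = Y.count U + (X.count U + 1) := by
    simp
    omega
  have hpeak {a : ℕ} (h₁ : 1 ≤ a) (h₂ : a ≤ Y.count U + X.count U) :
      shiftLetter (X.count D + 1) (tunnelEnd (X ++ Y) (Y.count U + X.count U + 1 - a)) =
      tunnelEnd (X ++ U :: D :: Y)
        (shiftLetter (X.count U + 1) (Y.count U + X.count U + 1 - a)) :=
    (h.isTunnel_tunnelEnd (by omega) (by omega)).insert_peak.tunnelEnd_eq.symm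
  simp only [ins, shiftFrom_eq_map, PhiInv_eq_map_tunnelEnd, hcount, hcount', List.map_map]
  rw [← List.map_take, ← List.map_drop, ← List.range'_append_1 (n := X.count U + 1),
    ← List.range'_append_1 (n := X.count U), Nat.add_sub_cancel, List.take_left' (by simp),
    List.drop_left' (by simp), List.map_append, List.range'_succ, List.map_cons,
    Nat.add_comm 1 (Y.count U), Nat.add_comm (Y.count U + 1) 1,
    ← List.map_add_range', List.map_map]
  refine congrArg₂ (· ++ ·) (List.map_congr_left fun a ha => ?_)
    (congrArg₂ List.cons ?_ (List.map_congr_left fun a ha => ?_))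
  · rw [List.mem_range'_1] at ha
    rw [Function.comp_apply, hpeak (by omega) (by omega), shiftLetter_of_le (by omega)]
    congr 1
    omega
  · rw [← (isTunnel_peak h).tunnelEnd_eq]
    congr 1
    omega
  · rw [List.mem_range'_1] at ha
    rw [Function.comp_apply, Function.comp_apply, hpeak (by omega) (by omega),
      shiftLetter_of_lt (by omega)]
    congr 1
    omega

theorem map_add_append_mem_Av_132 {p m : ℕ} {s t : List ℕ} (hs : s ∈ Av p [1, 3, 2])
    (ht : t ∈ Av m [1, 3, 2]) :
    s.map (m + 1 + ·) ++ (t ++ [m + 1]) ∈ Av (p + (m + 1)) [1, 3, 2] := by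
  have hs' := mem_S_iff.1 hs.1
  have ht' := mem_S_iff.1 ht.1
  constructor
  · calc s.map (m + 1 + ·) ++ (t ++ [m + 1])
        ~ (List.range' 1 p).map (m + 1 + ·) ++ (List.range' 1 m ++ [m + 1]) :=
          (List.Perm.map _ hs.1).append (List.Perm.append_right _ ht.1)
      _ ~ List.range' 1 (p + (m + 1)) := by
          rw [List.map_add_range', Nat.add_comm m, ← List.range'_1_concat, Nat.add_comm p,
            ← List.range'_append_1 (n := p), Nat.add_right_comm, Nat.add_comm m 1,
            ← Nat.add_assoc]
          exact List.perm_append_comm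
  · have hbig : ∀ x ∈ s.map (m + 1 + ·), m + 1 < x := by
      simp only [List.mem_map, hs'.2]
      omega
    have hsmall : ∀ x ∈ t, x < m + 1 := fun x hx => Nat.lt_succ_of_le ((ht'.2 x).1 hx).2
    have hle : ∀ x ∈ t ++ [m + 1], x ≤ m + 1 := by
      simpa [or_imp, forall_and] using fun x hx => (hsmall x hx).le
    rw [not_contains_132_iff, List.triplewise_append, List.triplewise_append, List.triplewise_map]
    refine ⟨by simpa using not_contains_132_iff.1 hs.2, ⟨not_contains_132_iff.1 ht.2, by simp,
      by simp, ?_⟩, fun a ha => ?_, fun a ha => ?_⟩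
    · rw [List.forall_mem_singleton]
      exact List.pairwise_of_forall_mem_list fun x _ y hy => by grind
    · exact List.pairwise_of_forall_mem_list fun x _ y hy => by grind
    · exact List.pairwise_of_forall_mem_list fun x hx y _ => by grind

theorem filter_append_filter_of_pairwise {v : ℕ} {l : List ℕ} (hv : v ∉ l)
    (h : l.Pairwise fun x y => ¬ (x < v ∧ v < y)) :
    l.filter (v < ·) ++ l.filter (· < v) = l := by
  induction l with
  | nil => rfl
  | cons a l ih =>
    obtain ⟨hhead, htail⟩ := List.pairwise_cons.1 h
    obtain ⟨hne, hvl⟩ := not_or.1 (List.mem_cons.not.1 hv)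
    rcases lt_or_gt_of_ne hne with hva | hav
    · rw [List.filter_cons_of_pos (by simpa), List.filter_cons_of_neg (by simpa using hva.le),
        List.cons_append, ih hvl htail]
    · have hlt : ∀ y ∈ l, y < v := fun y hy => by
        have hyv : y ≠ v := fun h => hvl (h ▸ hy)
        have := hhead y hy
        omega
      have hfilter : l.filter (v < ·) = [] := List.filter_eq_nil_iff.2 fun y hy => by
        simpa using (hlt y hy).le
      rw [List.filter_cons_of_neg (by simpa using hav.le), List.filter_cons_of_pos (by simpa),
        hfilter, List.nil_append, List.filter_eq_self.2 fun y hy => by simpa using hlt y hy]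

theorem exists_map_add_eq {v : ℕ} {l : List ℕ} (h : ∀ x ∈ l, v ≤ x) :
    ∃ s : List ℕ, s.map (v + ·) = l :=
  ⟨l.map (· - v), by
    rw [List.map_map]
    exact (List.map_congr_left fun x hx => Nat.add_sub_cancel' (h x hx)).trans (List.map_id l)⟩

theorem exists_eq_map_add_append {n : ℕ} {α : List ℕ} (hα : α ∈ Av (n + 1) [1, 3, 2]) :
    ∃ p m, p + m = n ∧ ∃ s ∈ Av p [1, 3, 2], ∃ t ∈ Av m [1, 3, 2],
      α = s.map (m + 1 + ·) ++ (t ++ [m + 1]) := by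
  have hlen : α.length = n + 1 := length_of_mem_S hα.1
  obtain ⟨l, v, rfl⟩ := List.eq_nil_or_concat' α |>.resolve_left (by rintro rfl; simp at hlen)
  obtain ⟨hnodup, hmem⟩ := mem_S_iff.1 hα.1
  obtain ⟨hl, -, hdisj⟩ := List.nodup_append.1 hnodup
  have hv : v ∉ l := fun h => hdisj v h v (by simp) rfl
  obtain ⟨hv₁, hv₂⟩ := (hmem v).1 (by simp)
  have hmem' (x : ℕ) : x ∈ l ↔ (1 ≤ x ∧ x ≤ n + 1) ∧ x ≠ v := by
    rw [← hmem, List.mem_append, List.mem_singleton]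
    grind
  obtain ⟨havoid, -, -, hlast⟩ := List.triplewise_append.1 (not_contains_132_iff.1 hα.2)
  have havoid_of {u : List ℕ} (hu : u <+ l) : u.Triplewise fun x y z => ¬ (x < z ∧ z < y) :=
    triplewise_iff_forall_sublist.2 fun _ _ _ h =>
      triplewise_iff_forall_sublist.1 havoid _ _ _ (h.trans hu)
  have hsplit := filter_append_filter_of_pairwise hv (hlast v (by simp))
  obtain ⟨s, hs⟩ := exists_map_add_eq (v := v) (l := l.filter (v < ·)) fun x hx => by
    simpa using (of_decide_eq_true (List.mem_filter.1 hx).2).le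
  obtain ⟨m, rfl⟩ := Nat.exists_eq_add_of_le' hv₁
  have hs_avoid : (s.map (m + 1 + ·)).Triplewise fun x y z => ¬ (x < z ∧ z < y) :=
    hs ▸ havoid_of List.filter_sublist
  have hs_mem (x : ℕ) : x ∈ s ↔ 1 ≤ x ∧ x ≤ n - m := by
    rw [← List.mem_map_of_injective (add_right_injective (m + 1)), hs, List.mem_filter, hmem',
      decide_eq_true_iff]
    omega
  refine ⟨n - m, m, by omega, s, ⟨mem_S_iff.2 ⟨.of_map _ (hs ▸ hl.filter _), hs_mem⟩, ?_⟩,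
    l.filter (· < m + 1), ⟨mem_S_iff.2 ⟨hl.filter _, fun x => ?_⟩, ?_⟩, ?_⟩
  · simpa [not_contains_132_iff, List.triplewise_map] using hs_avoid
  · rw [List.mem_filter, hmem', decide_eq_true_iff]
    omega
  · exact not_contains_132_iff.2 (havoid_of List.filter_sublist)
  · rw [hs, ← List.append_assoc, hsplit]

theorem PhiInv_mem_Av {w : List DyckStep} (hw : IsDyck w) :
    PhiInv w ∈ Av (w.count U) [1, 3, 2] := by
  induction hw using IsDyck.induction with
  | nil => exact ⟨.refl _, not_contains_132_iff.2 .nil⟩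
  | nest B C hB hC ihB ihC =>
    rw [PhiInv_nest hB hC, show (U :: (B ++ D :: C)).count U = C.count U + (B.count U + 1) by
      simp; omega]
    exact map_add_append_mem_Av_132 ihC ihB

theorem exists_PhiInv_eq {n : ℕ} {α : List ℕ} (hα : α ∈ Av n [1, 3, 2]) :
    ∃ w, IsDyck w ∧ w.count U = n ∧ PhiInv w = α := by
  induction n using Nat.strong_induction_on generalizing α with
  | h n ih =>
    cases n with
    | zero => exact ⟨[], isDyck_nil, rfl, (List.perm_nil.1 hα.1).symm⟩
    | succ n =>
      obtain ⟨p, m, rfl, s, hs, t, ht, rfl⟩ := exists_eq_map_add_append hα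
      obtain ⟨C, hC, rfl, rfl⟩ := ih p (by omega) hs
      obtain ⟨B, hB, rfl, rfl⟩ := ih m (by omega) ht
      exact ⟨_, hB.nest hC, by simp; omega, PhiInv_nest hB hC⟩

/-- The letter of index `p` (counted from `0`) of `w` is an up-step, and a down-step follows. -/
def HasPeakAt (w : List DyckStep) (p : ℕ) : Prop :=
  ∃ X Y, w = X ++ U :: D :: Y ∧ X.length = p

/-- The positions (counted from `0`) of the peaks of a Dyck word whose up-step lies in the left
half; the down-step may be the first letter of the right half. -/
def leftPeaks (w : List DyckStep) : Set ℕ := {p | p < w.count U ∧ HasPeakAt w p}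

theorem HasPeakAt.append_append {w : List DyckStep} {p : ℕ} (h : HasPeakAt w p)
    (A C : List DyckStep) : HasPeakAt (A ++ (w ++ C)) (A.length + p) := by
  obtain ⟨X, Y, rfl, rfl⟩ := h
  exact ⟨A ++ X, Y ++ C, by simp, by simp⟩

theorem hasPeakAt_iff_getElem? {w : List DyckStep} {p : ℕ} :
    HasPeakAt w p ↔ w[p]? = some U ∧ w[p + 1]? = some D := by
  refine ⟨?_, fun ⟨hU, hD⟩ => ⟨w.take p, w.drop (p + 2), ?_, ?_⟩⟩
  · rintro ⟨X, Y, rfl, rfl⟩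
    simp
  · obtain ⟨hp, hU⟩ := List.getElem?_eq_some_iff.1 hU
    obtain ⟨hp', hD⟩ := List.getElem?_eq_some_iff.1 hD
    conv_lhs => rw [← List.take_append_drop p w, List.drop_eq_getElem_cons hp,
      List.drop_eq_getElem_cons hp', hU, hD]
  · have := (List.getElem?_eq_some_iff.1 hU).1
    simp
    omega

theorem IsDyck.leftPeaks_nonempty {w : List DyckStep} (hw : IsDyck w) (hne : w ≠ []) :
    (leftPeaks w).Nonempty := by
  induction hw using IsDyck.induction with
  | nil => contradiction
  | nest B C hB _ ihB _ =>
    rcases eq_or_ne B [] with rfl | hB'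
    · exact ⟨0, by simp, [], C, rfl, rfl⟩
    · obtain ⟨p, hp, hpeak⟩ := ihB hB'
      exact ⟨1 + p, by simp; omega, hpeak.append_append [U] (D :: C)⟩

theorem IsDyck.exists_isGreatest_leftPeaks {w : List DyckStep} (hw : IsDyck w) (hne : w ≠ []) :
    ∃ X Y, w = X ++ U :: D :: Y ∧ IsGreatest (leftPeaks w) X.length := by
  have hbdd : BddAbove (leftPeaks w) := ⟨w.count U, fun p hp => hp.1.le⟩
  have hmem := Nat.sSup_mem (hw.leftPeaks_nonempty hne) hbdd
  obtain ⟨X, Y, hXY, hX⟩ := hmem.2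
  exact ⟨X, Y, hXY, hX ▸ hmem, hX ▸ fun p hp => le_csSup hbdd hp⟩

theorem hasPeakAt_insert_peak_iff {X Y : List DyckStep} {p : ℕ} (hp : X.length ≤ p) :
    HasPeakAt (X ++ U :: D :: Y) (p + 2) ↔ HasPeakAt (X ++ Y) p := by
  obtain ⟨q, rfl⟩ := Nat.exists_eq_add_of_le hp
  simp [hasPeakAt_iff_getElem?, Nat.add_assoc, List.getElem?_append_right]

theorem isGreatest_leftPeaks_insert_peak_iff {X Y : List DyckStep}
    (hX : X.length ≤ (X ++ Y).count U) :
    IsGreatest (leftPeaks (X ++ U :: D :: Y)) X.length ↔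
      ∀ p, X.length ≤ p → p + 1 < (X ++ Y).count U → ¬ HasPeakAt (X ++ Y) p := by
  have hcount : (X ++ U :: D :: Y).count U = (X ++ Y).count U + 1 := by
    simp [Nat.add_assoc]
  constructor
  · intro h p hp hpn hpeak
    have := h.2 ⟨by omega, (hasPeakAt_insert_peak_iff hp).2 hpeak⟩
    omega
  · refine fun h => ⟨⟨by omega, X, Y, rfl, rfl⟩, fun p ⟨hpn, hpeak⟩ => ?_⟩
    by_contra! hlt
    obtain ⟨q, rfl⟩ := Nat.exists_eq_add_of_le hlt
    cases q with
    | zero => simp [hasPeakAt_iff_getElem?] at hpeak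
    | succ q =>
      rw [show X.length + 1 + (q + 1) = X.length + q + 2 by omega] at hpeak hpn
      exact h _ (Nat.le_add_right _ q) (by omega)
        ((hasPeakAt_insert_peak_iff (Nat.le_add_right _ q)).1 hpeak)

theorem mem_nonExcedances_iff {w : List ℕ} {i : ℕ} :
    i ∈ nonExcedances w ↔ (1 ≤ i ∧ i ≤ w.length) ∧ letter w i ≤ i := by
  rw [nonExcedances, List.mem_filter, List.mem_range'_1, decide_eq_true_iff]
  omega

theorem mem_nonExcedances_PhiInv_iff {w : List DyckStep} {i : ℕ} :
    i ∈ nonExcedances (PhiInv w) ↔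
      (1 ≤ i ∧ i ≤ w.count U) ∧ tunnelEnd w (w.count U + 1 - i) ≤ i := by
  rw [mem_nonExcedances_iff, length_PhiInv]
  exact and_congr_right fun h => by rw [letter_PhiInv h.1 h.2]

/- A smaller non-excedance would come from a tunnel `u B d` that starts further to the right, and
whose end is so close to the middle that every up-step of `B` lies in the left half; the Dyck word
`u B d` would then contain a later peak. -/
theorem isLeast_nonExcedances_PhiInv {X Y : List DyckStep} (hw : IsDyck (X ++ U :: D :: Y))
    (hX : IsGreatest (leftPeaks (X ++ U :: D :: Y)) X.length) :
    IsLeast {i | i ∈ nonExcedances (PhiInv (X ++ U :: D :: Y))} (Y.count U + 1) := by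
  have hcount : (X ++ U :: D :: Y).count U = X.count U + 1 + Y.count U := by
    simp
    omega
  have hXlen := count_U_add_count_D X
  have hXn := hX.1.1
  constructor
  · refine mem_nonExcedances_PhiInv_iff.2 ⟨by omega, ?_⟩
    rw [hcount, show X.count U + 1 + Y.count U + 1 - (Y.count U + 1) = X.count U + 1 by omega,
      (isTunnel_peak (isDyck_peak_iff.1 hw)).tunnelEnd_eq]
    omega
  · intro i hi
    obtain ⟨⟨hi₁, hi₂⟩, hle⟩ := mem_nonExcedances_PhiInv_iff.1 hi
    obtain ⟨A, B, C, hABC, hB, -, hA, hend⟩ := hw.isTunnel_tunnelEnd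
      (i := (X ++ U :: D :: Y).count U + 1 - i) (by omega) (by omega)
    by_contra! hlt
    have hXA : (X ++ [U]) <+: A :=
      prefix_of_count_U_le (by simpa using hABC) (by simp; omega)
    have hXA_len : X.length + 1 ≤ A.length := by simpa using hXA.length_le
    have hUBD : IsDyck (U :: (B ++ [D])) := hB.nest isDyck_nil
    obtain ⟨p, hp, hpeak⟩ := hUBD.leftPeaks_nonempty (List.cons_ne_nil _ _)
    have hpB : p < B.count U + 1 := by simpa using hp
    have hpeak' : HasPeakAt (X ++ U :: D :: Y) (A.length + p) := by
      simpa [hABC] using hpeak.append_append A C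
    have hAlen := count_U_add_count_D A
    have hBcount := hB.count_U_eq_count_D
    have hAB : (A ++ B).count D = A.count D + B.count D := List.count_append
    have := hX.2 ⟨by omega, hpeak'⟩
    omega

theorem isDyck_Psi {n : ℕ} {w : List ℕ} (hw : w ∈ Av n [3, 2, 1]) : IsDyck (Psi w) := by
  induction n generalizing w with
  | zero =>
    obtain rfl : w = [] := List.perm_nil.1 hw.1
    exact isDyck_nil
  | succ n ih =>
    obtain ⟨hπ, hinc, h₁, h₂, hw_eq⟩ := exists_eq_ins_last hw
    rw [hw_eq, Psi_ins hπ h₁ h₂ hinc, isDyck_peak_iff, List.take_append_drop]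
    exact ih hπ

theorem count_U_Psi {n : ℕ} {w : List ℕ} (hw : w ∈ Av n [3, 2, 1]) : (Psi w).count U = n := by
  have hlen := length_Psi w
  rw [length_of_mem_S hw.1] at hlen
  have := (isDyck_Psi hw).count_U_eq_count_D
  have := count_U_add_count_D (Psi w)
  omega

theorem hasPeakAt_Psi_iff {n p : ℕ} {w : List ℕ} (hw : w ∈ Av n [3, 2, 1]) (hp : p + 1 < n) :
    HasPeakAt (Psi w) p ↔ [p + 2, p + 1] <+ w := by
  obtain ⟨hnodup, hmem⟩ := mem_S_iff.1 hw.1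
  have hlen := length_of_mem_S hw.1
  rw [hasPeakAt_iff_getElem?, getElem?_Psi (by omega), getElem?_Psi (by omega),
    ← mem_firstRow_and_succ_notMem_iff hnodup hw.2 ((hmem _).2 ⟨by omega, by omega⟩)
      ((hmem _).2 ⟨by omega, by omega⟩)]
  simp

theorem isGreatest_leftPeaks_Psi_iff {n k : ℕ} {w : List ℕ} (hw : w ∈ Av n [3, 2, 1])
    (h₁ : 1 ≤ k) (h₂ : k ≤ n + 1) :
    IsGreatest (leftPeaks ((Psi w).take (k - 1) ++ U :: D :: (Psi w).drop (k - 1))) (k - 1) ↔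
      IncreasingFrom k w := by
  obtain ⟨k, rfl⟩ := Nat.exists_eq_add_of_le' h₁
  rw [Nat.add_sub_cancel]
  have hlen : ((Psi w).take k).length = k := by
    rw [List.length_take, length_Psi, length_of_mem_S hw.1]
    omega
  have hiff := isGreatest_leftPeaks_insert_peak_iff (X := (Psi w).take k) (Y := (Psi w).drop k)
  rw [hlen, List.take_append_drop, count_U_Psi hw] at hiff
  rw [hiff (by omega), increasingFrom_iff hw.1 h₁]
  constructor
  · intro h i hki hin
    obtain ⟨p, rfl⟩ := Nat.exists_eq_add_of_le' (h₁.trans hki)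
    exact fun hsub => h p (by omega) hin ((hasPeakAt_Psi_iff hw hin).2 hsub)
  · exact fun h p hkp hpn hpeak => h (p + 1) (by omega) hpn ((hasPeakAt_Psi_iff hw hpn).1 hpeak)

theorem exists_Psi_eq {n : ℕ} {w : List DyckStep} (hw : IsDyck w) (hn : w.count U = n) :
    ∃ σ ∈ Av n [3, 2, 1], Psi σ = w := by
  induction n generalizing w with
  | zero => exact ⟨[], ⟨.refl _, not_contains_321_iff.2 .nil⟩, (hw.eq_nil hn).symm⟩
  | succ n ih =>
    obtain ⟨X, Y, rfl, hX⟩ := hw.exists_isGreatest_leftPeaks (by rintro rfl; simp at hn)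
    obtain ⟨π, hπ, hXY⟩ := ih (isDyck_peak_iff.1 hw) (by simp at hn ⊢; omega)
    have hXn : X.length ≤ n := Nat.le_of_lt_succ (hX.1.1.trans_eq hn)
    have hinc : IncreasingFrom (X.length + 1) π :=
      (isGreatest_leftPeaks_Psi_iff hπ (by omega) (by omega)).1 (by simpa [hXY] using hX)
    refine ⟨ins π (n + 1) (X.length + 1),
      (ins_last_mem_Av_iff (by omega) (by omega)).2 ⟨hπ, hinc⟩, ?_⟩
    rw [Psi_ins hπ (by omega) (by omega) hinc, hXY]
    simp

theorem matchedBelow_lt {n k : ℕ} {w : List ℕ} (hw : w ∈ Av n [3, 2, 1]) (h₁ : 1 ≤ k)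
    (h₂ : k ≤ n + 1) : matchedBelow w k < k := by
  rw [← count_D_take_Psi hw h₂]
  have := List.count_le_length (a := D) (l := (Psi w).take (k - 1))
  rw [List.length_take] at this
  omega

theorem count_U_drop_Psi {n k : ℕ} {w : List ℕ} (hw : w ∈ Av n [3, 2, 1]) (h₁ : 1 ≤ k)
    (h₂ : k ≤ n + 1) : ((Psi w).drop (k - 1)).count U = n + 1 - k + matchedBelow w k := by
  have hcount := count_U_Psi hw
  rw [← List.take_append_drop (k - 1) (Psi w), List.count_append] at hcount
  have hlen := count_U_add_count_D ((Psi w).take (k - 1))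
  rw [List.length_take, length_Psi, length_of_mem_S hw.1, count_D_take_Psi hw h₂] at hlen
  omega

theorem Theta_ins {n k : ℕ} {w : List ℕ} (hw : w ∈ Av n [3, 2, 1]) (h₁ : 1 ≤ k)
    (h₂ : k ≤ n + 1) (hinc : IncreasingFrom k w) :
    Theta (ins w (n + 1) k) =
      ins (Theta w) (n + 1 - k + (matchedBelow w k + 1)) (matchedBelow w k + 1) := by
  have hdyck : IsDyck ((Psi w).take (k - 1) ++ (Psi w).drop (k - 1)) := by
    simpa using isDyck_Psi hw
  rw [Theta, Psi_ins hw h₁ h₂ hinc, PhiInv_peak hdyck, List.take_append_drop,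
    count_U_drop_Psi hw h₁ h₂, count_D_take_Psi hw h₂, Theta, Nat.add_assoc]

theorem isLeast_nonExcedances_Theta_ins {n k : ℕ} {w : List ℕ} (hw : w ∈ Av n [3, 2, 1])
    (h₁ : 1 ≤ k) (h₂ : k ≤ n + 1) (hinc : IncreasingFrom k w) :
    IsLeast {i | i ∈ nonExcedances (Theta (ins w (n + 1) k))}
      (n + 1 - k + (matchedBelow w k + 1)) := by
  have hlen : ((Psi w).take (k - 1)).length = k - 1 := by
    rw [List.length_take, length_Psi, length_of_mem_S hw.1]
    omega
  rw [Theta, Psi_ins hw h₁ h₂ hinc, ← Nat.add_assoc, ← count_U_drop_Psi hw h₁ h₂]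
  refine isLeast_nonExcedances_PhiInv (isDyck_peak_iff.2 (by simpa using isDyck_Psi hw)) ?_
  rw [hlen]
  exact (isGreatest_leftPeaks_Psi_iff hw h₁ h₂).2 hinc

theorem Theta_mapsTo (n : ℕ) : Set.MapsTo Theta (Av n [3, 2, 1]) (Av n [1, 3, 2]) := by
  intro σ hσ
  rw [← count_U_Psi hσ]
  exact PhiInv_mem_Av (isDyck_Psi hσ)

theorem Theta_surjOn (n : ℕ) : Set.SurjOn Theta (Av n [3, 2, 1]) (Av n [1, 3, 2]) := by
  intro α hα
  obtain ⟨w, hw, hn, rfl⟩ := exists_PhiInv_eq hα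
  obtain ⟨σ, hσ, rfl⟩ := exists_Psi_eq hw hn
  exact ⟨σ, hσ, rfl⟩

theorem Theta_recursion {n k j : ℕ} {σ π : List ℕ} (hσ : σ ∈ Av (n + 1) [3, 2, 1])
    (hk : k = letter σ (n + 1)) (hπ : π = red (σ.take n)) (hj : j = matchedBelow σ k + 1) :
    π ∈ Av n [3, 2, 1] ∧ σ = ins π (n + 1) k ∧ j = matchedBelow π k + 1 ∧
      Theta σ = ins (Theta π) (n + 1 - k + j) j ∧
      IsLeast {i | i ∈ nonExcedances (Theta σ)} (n + 1 - k + j) := by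
  obtain ⟨hπ_mem, hinc, h₁, h₂, hσ_eq⟩ := exists_eq_ins_last hσ
  simp only [← hk, ← hπ] at hπ_mem hinc h₁ h₂ hσ_eq
  rw [hσ_eq, matchedBelow_ins hπ_mem h₁ h₂ hinc] at hj
  subst hj
  refine ⟨hπ_mem, hσ_eq, rfl, ?_, ?_⟩ <;> rw [hσ_eq]
  · exact Theta_ins hπ_mem h₁ h₂ hinc
  · exact isLeast_nonExcedances_Theta_ins hπ_mem h₁ h₂ hinc

theorem exists_Theta_eq_ins {n : ℕ} {σ : List ℕ} (hσ : σ ∈ Av (n + 1) [3, 2, 1]) :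
    ∃ π ∈ Av n [3, 2, 1], ∃ k j, k ≤ n + 1 ∧ σ = ins π (n + 1) k ∧
      Theta σ = ins (Theta π) (n + 1 - k + j) j ∧
      IsLeast {i | i ∈ nonExcedances (Theta σ)} (n + 1 - k + j) ∧
      letter (Theta σ) (n + 1 - k + j) = j := by
  obtain ⟨-, -, h₁, h₂, -⟩ := exists_eq_ins_last hσ
  obtain ⟨hπ, hσ_eq, hj, hΘ, hleast⟩ := Theta_recursion hσ rfl rfl rfl
  refine ⟨_, hπ, _, _, h₂, hσ_eq, hΘ, hleast, ?_⟩
  have hlt := matchedBelow_lt hπ h₁ h₂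
  rw [hΘ, letter_ins (by omega)]
  rw [length_of_mem_S (Theta_mapsTo n hπ).1]
  omega

theorem Theta_injOn (n : ℕ) : Set.InjOn Theta (Av n [3, 2, 1]) := by
  induction n with
  | zero => exact fun σ hσ σ' hσ' _ => hσ.1.eq_nil.trans hσ'.1.eq_nil.symm
  | succ n ih =>
    intro σ hσ σ' hσ' heq
    obtain ⟨π, hπ, k, j, hk, rfl, hΘ, hleast, hletter⟩ := exists_Theta_eq_ins hσ
    obtain ⟨π', hπ', k', j', hk', rfl, hΘ', hleast', hletter'⟩ := exists_Theta_eq_ins hσ'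
    rw [← heq] at hΘ' hleast' hletter'
    have hpos := hleast.unique hleast'
    obtain rfl : j = j' := by rw [← hletter, hpos, hletter']
    obtain rfl : k = k' := by omega
    have hlen : (Theta π).length = (Theta π').length := by
      rw [length_of_mem_S (Theta_mapsTo n hπ).1, length_of_mem_S (Theta_mapsTo n hπ').1]
    rw [ih hπ hπ' (ins_injective hlen (hΘ.symm.trans hΘ'))]

theorem Theta_bijOn (n : ℕ) : Set.BijOn Theta (Av n [3, 2, 1]) (Av n [1, 3, 2]) :=
  ⟨Theta_mapsTo n, Theta_injOn n, Theta_surjOn n⟩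

theorem Theta_injOn_iUnion : Set.InjOn Theta (⋃ n, Av n [3, 2, 1]) := by
  intro σ hσ σ' hσ' heq
  obtain ⟨n, hn⟩ := Set.mem_iUnion.1 hσ
  obtain ⟨m, hm⟩ := Set.mem_iUnion.1 hσ'
  obtain rfl : n = m := by
    rw [← length_of_mem_S (Theta_mapsTo n hn).1, heq, length_of_mem_S (Theta_mapsTo m hm).1]
  exact Theta_injOn n hn hm heq

theorem ThetaInv_Theta {n : ℕ} {σ : List ℕ} (hσ : σ ∈ Av n [3, 2, 1]) :
    ThetaInv (Theta σ) = σ :=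
  Theta_injOn_iUnion.leftInvOn_invFunOn (Set.mem_iUnion.2 ⟨n, hσ⟩)

theorem ThetaInv_recursion {n : ℕ} {α : List ℕ} (hα : α ∈ Av (n + 1) [1, 3, 2]) :
    ∃ k, IsLeast {i | i ∈ nonExcedances α} k ∧ ∃ β ∈ Av n [1, 3, 2],
      ins β k (letter α k) = α ∧ (∀ β' ∈ S n, ins β' k (letter α k) = α → β' = β) ∧
      ThetaInv α = ins (ThetaInv β) (n + 1) (n + 1 + letter α k - k) := by
  obtain ⟨σ, hσ, rfl⟩ := Theta_surjOn _ hα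
  obtain ⟨π, hπ, k, j, hk, hσ_eq, hΘ, hleast, hletter⟩ := exists_Theta_eq_ins hσ
  have hΘπ := Theta_mapsTo n hπ
  refine ⟨_, hleast, Theta π, hΘπ, by rw [hletter, ← hΘ], fun β' hβ' h => ?_, ?_⟩
  · rw [hletter, hΘ] at h
    exact ins_injective ((length_of_mem_S hβ').trans (length_of_mem_S hΘπ.1).symm) h
  · rwa [ThetaInv_Theta hσ, ThetaInv_Theta hπ, hletter,
      show n + 1 + j - (n + 1 - k + j) = k by omega]

end ElizaldePak

theorem mainTheorem3 (n : ℕ) :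
    Set.BijOn ElizaldePak.Theta (ElizaldePak.Av n [3, 2, 1]) (ElizaldePak.Av n [1, 3, 2]) ∧
    (∀ σ ∈ ElizaldePak.Av n [3, 2, 1],
      (n = 1 → ElizaldePak.Theta σ = σ) ∧
      (1 < n → ∀ (k : ℕ) (π : List ℕ) (j : ℕ),
        k = ElizaldePak.letter σ n →
        π = ElizaldePak.red (σ.take (n - 1)) →
        j = ElizaldePak.matchedBelow σ k + 1 →
          π ∈ ElizaldePak.Av (n - 1) [3, 2, 1] ∧
          σ = ElizaldePak.ins π n k ∧
          j = ElizaldePak.matchedBelow π k + 1 ∧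
          ElizaldePak.Theta σ = ElizaldePak.ins (ElizaldePak.Theta π) (n - k + j) j ∧
          IsLeast {i | i ∈ ElizaldePak.nonExcedances (ElizaldePak.Theta σ)} (n - k + j))) ∧
    (∀ α ∈ ElizaldePak.Av n [1, 3, 2],
      (n = 1 → ElizaldePak.ThetaInv α = α) ∧
      (1 < n → ∃ k, IsLeast {i | i ∈ ElizaldePak.nonExcedances α} k ∧
        ∃ β ∈ ElizaldePak.Av (n - 1) [1, 3, 2],
          ElizaldePak.ins β k (ElizaldePak.letter α k) = α ∧
          (∀ β' ∈ ElizaldePak.S (n - 1),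
            ElizaldePak.ins β' k (ElizaldePak.letter α k) = α → β' = β) ∧
          ElizaldePak.ThetaInv α =
            ElizaldePak.ins (ElizaldePak.ThetaInv β) n (n + ElizaldePak.letter α k - k))) := by
  open ElizaldePak in
  refine ⟨Theta_bijOn n, fun σ hσ => ⟨?_, fun hn k π j hk hπ hj => ?_⟩,
    fun α hα => ⟨?_, fun hn => ?_⟩⟩
  · rintro rfl
    rw [eq_of_mem_S_one (Theta_mapsTo 1 hσ).1, eq_of_mem_S_one hσ.1]
  · obtain ⟨n, rfl⟩ := Nat.exists_eq_add_of_le' hn.le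
    exact Theta_recursion hσ hk hπ hj
  · rintro rfl
    obtain ⟨σ, hσ, rfl⟩ := Theta_surjOn 1 hα
    rw [ThetaInv_Theta hσ, eq_of_mem_S_one hα.1, eq_of_mem_S_one hσ.1]
  · obtain ⟨n, rfl⟩ := Nat.exists_eq_add_of_le' hn.le
    exact ThetaInv_recursion hα
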